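/- Let $n\ge 1$, let $s\in(0,1)$ and $\mathfrak r\in[1,\infty)$. There is a constant $c=c_{n,s,\mathfrak r}>0$, depending only on $n,s,\mathfrak r$, such that the following holds for every $m>0$, every multi-index $\beta\in\mathbb N_0^n$ with $|\beta|\ge 2$, all $\mathfrak p\in[1,\infty)$ and $\mathfrak q\in(1,\infty)$ with $\mathfrak p^{-1}+\mathfrak q^{-1}+\mathfrak r^{-1}=2$, every $d>0$, and all $\Phi,\chi\in C^\infty(\mathbb R^n)\cap L^\infty(\mathbb R^n)$ (complex valued) with $\operatorname{dist}(\operatorname{supp}\chi,\operatorname{supp}\Phi)\ge d$. Let $\mathfrak q^*$ be given by $\mathfrak q^{-1}+(\mathfrak q^{*})^{-1}=1$, and let $(-\Delta+m^2)^{-s}$ be the Fourier multiplier with symbol $(|\xi|^2+m^2)^{-s}$ (where $-\Delta$ has symbol $|\xi|^2$). Then the operator $f\mapsto \Phi\,(-\Delta+m^2)^{-s}D^\beta(\chi f)$, understood in the sense of distributions, is bounded from $L^{\mathfrak p}(\mathbb R^n)$ to $L^{\mathfrak q^*}(\mathbb R^n)$, and $$\big\|\Phi(-\Delta+m^2)^{-s}D^\beta\chi\big\|_{L^{\mathfrak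 p}\to L^{\mathfrak q^*}}\le c\,\beta!\,\Big(\frac{2n+2}{d}\Big)^{|\beta|-2s+n(1-1/\mathfrak r)}\|\Phi\|_\infty\|\chi\|_\infty .$$ If $s=1/2$, the same boundedness and the same estimate hold with $(-\Delta+m^2)^{-s}$ replaced by $\big((-\Delta)^{1/2}+1\big)^{-1}$, the Fourier multiplier with symbol $(|\xi|+1)^{-1}$. -/

import Mathlib

open MeasureTheory FourierTransform
open scoped ENNReal ContDiff Nat

noncomputable section

/-- The `i`-th partial derivative of a function on `ℝⁿ`. -/
def partialDeriv {n : ℕ} (i : Fin n) (u : EuclideanSpace ℝ (Fin n) → ℂ) :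
    EuclideanSpace ℝ (Fin n) → ℂ :=
  fun x => lineDeriv ℝ u x (EuclideanSpace.single i 1)

/-- `D^β = ∂₁^{β₁} ⋯ ∂ₙ^{βₙ}` for a multi-index `β` (used on smooth functions only). -/
def multiDeriv {n : ℕ} (β : Fin n → ℕ) (u : EuclideanSpace ℝ (Fin n) → ℂ) :
    EuclideanSpace ℝ (Fin n) → ℂ :=
  (List.finRange n).foldr (fun i v => (partialDeriv i)^[β i] v) u

/-- The Fourier multiplier `u ↦ 𝓕⁻¹ (σ · 𝓕 u)`. With Mathlib's normalization
`𝓕 u ξ = ∫ e^{-2πi⟨x,ξ⟩} u x`, the operator `-Δ` has the symbol `(2π‖ξ‖)²`. -/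
def symbolOp {n : ℕ} (σ : EuclideanSpace ℝ (Fin n) → ℝ) (u : EuclideanSpace ℝ (Fin n) → ℂ) :
    EuclideanSpace ℝ (Fin n) → ℂ :=
  𝓕⁻ (fun ξ => (σ ξ : ℂ) * 𝓕 u ξ)

/-- The symbol of `(-Δ + m²)^{-s}`. -/
def massiveSymbol (n : ℕ) (s m : ℝ) (ξ : EuclideanSpace ℝ (Fin n)) : ℝ :=
  ((2 * Real.pi * ‖ξ‖) ^ 2 + m ^ 2) ^ (-s)

/-- The symbol of `((-Δ)^{1/2} + 1)^{-1}`. -/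
def masslessSymbol (n : ℕ) (ξ : EuclideanSpace ℝ (Fin n)) : ℝ :=
  (2 * Real.pi * ‖ξ‖ + 1)⁻¹

/-- `g = Φ σ(p) D^β (χ f)` in the sense of distributions on `ℝⁿ`, where `D^β`, the Fourier
multiplier `σ(p)` (with real even symbol `σ`) and multiplication by `Φ` act by transposition:
`⟨Φ σ(p) D^β (χ f), ψ⟩ = ⟨D^β (χ f), σ(p) (Φ ψ)⟩ = (-1)^{|β|} ∫ χ f D^β (σ(p) (Φ ψ))`
for every test function `ψ`, the last integral being absolutely convergent. -/
def IsOperatorValue {n : ℕ} (σ : EuclideanSpace ℝ (Fin n) → ℝ) (β : Fin n → ℕ)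
    (Φ χ f g : EuclideanSpace ℝ (Fin n) → ℂ) : Prop :=
  ∀ ψ : EuclideanSpace ℝ (Fin n) → ℂ, ContDiff ℝ ∞ ψ → HasCompactSupport ψ →
    Integrable (fun x => χ x * f x * multiDeriv β (symbolOp σ (fun y => Φ y * ψ y)) x) ∧
    ∫ x, g x * ψ x =
      (-1) ^ (∑ i, β i) *
        ∫ x, χ x * f x * multiDeriv β (symbolOp σ (fun y => Φ y * ψ y)) x

/-- The bounded operator `T : L^p → L^{q'}` is the operator `Φ σ(p) D^β χ`. -/
def IsLocalizedOperator {n : ℕ} (σ : EuclideanSpace ℝ (Fin n) → ℝ) (β : Fin n → ℕ)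
    (Φ χ : EuclideanSpace ℝ (Fin n) → ℂ) {p q' : ℝ≥0∞} [Fact (1 ≤ p)] [Fact (1 ≤ q')]
    (T : Lp ℂ p (volume : Measure (EuclideanSpace ℝ (Fin n))) →L[ℂ]
      Lp ℂ q' (volume : Measure (EuclideanSpace ℝ (Fin n)))) : Prop :=
  ∀ f : Lp ℂ p (volume : Measure (EuclideanSpace ℝ (Fin n))), IsOperatorValue σ β Φ χ f (T f)

/-- The norm of `L^∞(ℝⁿ)`. -/
def supNorm {n : ℕ} (u : EuclideanSpace ℝ (Fin n) → ℂ) : ℝ :=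
  (eLpNorm u ⊤ volume).toReal

/-- `c β! ((2n+2)/d)^{|β| - 2s + n(1 - 1/r)} ‖Φ‖_∞ ‖χ‖_∞`. -/
def smoothingBound {n : ℕ} (c s : ℝ) (r : ℝ≥0∞) (β : Fin n → ℕ) (d : ℝ)
    (Φ χ : EuclideanSpace ℝ (Fin n) → ℂ) : ℝ :=
  c * ((∏ i, (β i)! : ℕ) : ℝ) *
    ((2 * (n : ℝ) + 2) / d) ^
      (((∑ i, β i : ℕ) : ℝ) - 2 * s + (n : ℝ) * (1 - 1 / r.toReal)) *
    supNorm Φ * supNorm χ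

end

/-! Both symbols are superpositions of heat symbols, `σ(ξ) = ∫₀^∞ w(t) exp(-t(2π‖ξ‖)²) dt` with `0 ≤
w(t) ≤ t^(s-1)/Γ(s)` (`IsSubordinated`). The mass enters `w` only through a factor at most 1, so no
bound depends on `m`. Between separated supports `σ(p) D^β` therefore acts through the kernel `K(z)
= ∫₀^∞ w(t) D^β h_t(z) dt`, with `h_t` the heat kernel, and only its part on `‖z‖ ≥ d` matters.

The core is the bound `|K(z)| ≤ const · β! ((2n+2)/‖z‖)^|β| ‖z‖^(2s-n)`. The heat kernel is a
product of entire one-variable Gaussians, and Cauchy's estimate in each variable, with radius the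
fraction `1/(2n+2)` of the length of the rescaled argument, produces the factorials and the power.
For `t ≤ ‖z‖²` Gaussian decay controls the time integral; for later times a derivative ignores
constants, which gains `‖z‖²/t` and gives convergence at infinity in every dimension
(`lintegral_heatDeriv_le`).

Because `|β| ≥ 2`, the tail of `K` is dominated by a multiple of a fixed `L^r` profile rescaled by
`d` (`eLpNorm_subordKernelTail_le`), and Young's inequality gives the operator bound. To identify
this operator with the distributional one, `D^β` is commuted past the multiplier on test functions,
moved onto the heat kernel by parts, and the integrals are exchanged
(`IsSubordinated.multiDeriv_symbolOp_eq`). -/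

/-! ### Young's convolution inequality. -/

section Young

variable {G : Type*} [MeasurableSpace G] [AddCommGroup G] [MeasurableAdd₂ G] [MeasurableNeg G]
  {μ : Measure G} [SFinite μ] [μ.IsAddLeftInvariant] [μ.IsNegInvariant]

/-- Young's convolution inequality for nonnegative functions, in integrated form. -/
theorem lintegral_rpow_lintegral_sub_mul_le {f k : G → ℝ≥0∞} (hf : AEMeasurable f μ)
    (hk : Measurable k) {p r a : ℝ} (hp : 1 ≤ p) (hr : 1 ≤ r) (ha : 0 < a)
    (h : 1 + a⁻¹ = p⁻¹ + r⁻¹) :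
    ∫⁻ y, (∫⁻ x, k (x - y) * f x ∂μ) ^ a ∂μ ≤
      (∫⁻ x, k x ^ r ∂μ) ^ (a / r) * (∫⁻ x, f x ^ p ∂μ) ^ (a / p) := by
  have hp0 : 0 < p := by linarith
  have hr0 : 0 < r := by linarith
  have hp1 : p⁻¹ ≤ 1 := inv_le_one_of_one_le₀ hp
  have hr1 : r⁻¹ ≤ 1 := inv_le_one_of_one_le₀ hr
  have ha1 : 0 < a⁻¹ := inv_pos.2 ha
  set A := ∫⁻ x, f x ^ p ∂μ with hA
  set B := ∫⁻ x, k x ^ r ∂μ with hB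
  have hka : ∀ y, Measurable fun x => k (x - y) := fun y => hk.comp (measurable_sub_const y)
  -- Hölder for three functions, with weights `1/a`, `1/r - 1/a`, `1/p - 1/a` summing to 1. By
  -- translation invariance only the first factor still depends on `y`.
  have key : ∀ y, ∫⁻ x, k (x - y) * f x ∂μ ≤
      (∫⁻ x, k (x - y) ^ r * f x ^ p ∂μ) ^ a⁻¹ * (B ^ (r⁻¹ - a⁻¹) * A ^ (p⁻¹ - a⁻¹)) := by
    intro y
    have hol := ENNReal.lintegral_prod_norm_pow_le (μ := μ) (Finset.univ : Finset (Fin 3))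
      (f := ![fun x => k (x - y) ^ r * f x ^ p, fun x => k (x - y) ^ r, fun x => f x ^ p])
      (p := ![a⁻¹, r⁻¹ - a⁻¹, p⁻¹ - a⁻¹]) ?_ ?_ ?_
    · simp only [Fin.prod_univ_three, Matrix.cons_val_zero, Matrix.cons_val_one,
        Matrix.cons_val_two, Matrix.head_cons, Matrix.tail_cons] at hol
      rw [lintegral_sub_right_eq_self (fun x => k x ^ r) y, mul_assoc] at hol
      refine le_trans (le_of_eq (lintegral_congr fun x => ?_)) hol
      rw [ENNReal.mul_rpow_of_nonneg _ _ ha1.le, ← ENNReal.rpow_mul, ← ENNReal.rpow_mul,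
        ← ENNReal.rpow_mul, ← ENNReal.rpow_mul]
      have e1 : k (x - y) = k (x - y) ^ (r * a⁻¹) * k (x - y) ^ (r * (r⁻¹ - a⁻¹)) := by
        rw [← ENNReal.rpow_add_of_nonneg _ _ (by positivity)
          (mul_nonneg hr0.le (by linarith))]
        rw [show r * a⁻¹ + r * (r⁻¹ - a⁻¹) = 1 by field_simp; ring, ENNReal.rpow_one]
      have e2 : f x = f x ^ (p * a⁻¹) * f x ^ (p * (p⁻¹ - a⁻¹)) := by
        rw [← ENNReal.rpow_add_of_nonneg _ _ (by positivity)
          (mul_nonneg hp0.le (by linarith))]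
        rw [show p * a⁻¹ + p * (p⁻¹ - a⁻¹) = 1 by field_simp; ring, ENNReal.rpow_one]
      conv_lhs => rw [e1, e2]
      ring
    · intro i _
      fin_cases i
      · exact ((hka y).aemeasurable.pow_const r).mul (hf.pow_const p)
      · exact (hka y).aemeasurable.pow_const r
      · exact hf.pow_const p
    · simp [Fin.sum_univ_three]; linarith
    · intro i _
      fin_cases i
      · exact ha1.le
      · show 0 ≤ r⁻¹ - a⁻¹
        linarith
      · show 0 ≤ p⁻¹ - a⁻¹
        linarith
  have hjoint : AEMeasurable (fun z : G × G => k (z.2 - z.1) ^ r * f z.2 ^ p) (μ.prod μ) :=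
    ((hk.comp (measurable_snd.sub measurable_fst)).pow_const r).aemeasurable.mul
      (hf.comp_snd.pow_const p)
  have hint : ∫⁻ y, ∫⁻ x, k (x - y) ^ r * f x ^ p ∂μ ∂μ = B * A := by
    rw [lintegral_lintegral_swap hjoint]
    have : ∀ x, ∫⁻ y, k (x - y) ^ r * f x ^ p ∂μ = B * f x ^ p := by
      intro x
      have hm : Measurable fun y => k (x - y) ^ r :=
        (hk.comp (measurable_const.sub measurable_id)).pow_const r
      rw [lintegral_mul_const _ hm,
        lintegral_sub_left_eq_self (fun x => k x ^ r) x]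
    simp_rw [this]
    rw [lintegral_const_mul'' _ (hf.pow_const p)]
  calc ∫⁻ y, (∫⁻ x, k (x - y) * f x ∂μ) ^ a ∂μ
      ≤ ∫⁻ y, (∫⁻ x, k (x - y) ^ r * f x ^ p ∂μ) *
          (B ^ (r⁻¹ - a⁻¹) * A ^ (p⁻¹ - a⁻¹)) ^ a ∂μ := by
        refine lintegral_mono fun y => ?_
        refine (ENNReal.rpow_le_rpow (key y) ha.le).trans (le_of_eq ?_)
        rw [ENNReal.mul_rpow_of_nonneg _ _ ha.le, ← ENNReal.rpow_mul, inv_mul_cancel₀ ha.ne',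
          ENNReal.rpow_one]
    _ = B * A * (B ^ (a / r - 1) * A ^ (a / p - 1)) := by
        rw [lintegral_mul_const'' _ hjoint.lintegral_prod_right', hint,
          ENNReal.mul_rpow_of_nonneg _ _ ha.le, ← ENNReal.rpow_mul, ← ENNReal.rpow_mul]
        congr 3 <;> field_simp
    _ = B ^ (a / r) * A ^ (a / p) := by
        have hq : ∀ t : ℝ, 0 ≤ t⁻¹ - a⁻¹ → 0 ≤ a / t - 1 := by
          intro t ht
          have := mul_nonneg ha.le ht
          rw [mul_sub, mul_inv_cancel₀ ha.ne', ← div_eq_mul_inv] at this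
          exact this
        have e : ∀ (X : ℝ≥0∞) (t : ℝ), 0 ≤ t⁻¹ - a⁻¹ → X * X ^ (a / t - 1) = X ^ (a / t) := by
          intro X t ht
          nth_rewrite 1 [← ENNReal.rpow_one X]
          rw [← ENNReal.rpow_add_of_nonneg _ _ zero_le_one (hq t ht)]
          congr 1; ring
        rw [← e B r (by linarith), ← e A p (by linarith)]
        ring

/-- Young's convolution inequality, absolute values inside the integral. -/
theorem eLpNorm_lintegral_sub_mul_le {F F' : Type*} [NormedAddCommGroup F] [NormedAddCommGroup F']
    [MeasurableSpace F'] [OpensMeasurableSpace F']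
    {f : G → F} {k : G → F'} (hf : AEStronglyMeasurable f μ)
    (hk : Measurable k) {p r a : ℝ≥0∞} (hp : 1 ≤ p) (hr : 1 ≤ r) (ha : 1 ≤ a)
    (hp' : p ≠ ⊤) (hr' : r ≠ ⊤) (ha' : a ≠ ⊤) (h : 1 + a⁻¹ = p⁻¹ + r⁻¹) :
    eLpNorm (fun y => ∫⁻ x, ‖k (x - y)‖ₑ * ‖f x‖ₑ ∂μ) a μ ≤ eLpNorm k r μ * eLpNorm f p μ := by
  have ne0 : ∀ {t : ℝ≥0∞}, 1 ≤ t → t ≠ 0 := fun ht => (zero_lt_one.trans_le ht).ne'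
  have pos : ∀ {t : ℝ≥0∞}, 1 ≤ t → t ≠ ⊤ → 1 ≤ t.toReal := fun ht ht' => by
    simpa using ENNReal.toReal_mono ht' ht
  have hp1 := pos hp hp'
  have hr1 := pos hr hr'
  have ha1 := pos ha ha'
  have hreal : 1 + a.toReal⁻¹ = p.toReal⁻¹ + r.toReal⁻¹ := by
    have := congrArg ENNReal.toReal h
    rwa [ENNReal.toReal_add (by simp) (by simpa using ne0 ha),
      ENNReal.toReal_add (by simpa using ne0 hp) (by simpa using ne0 hr), ENNReal.toReal_inv,
      ENNReal.toReal_inv, ENNReal.toReal_inv, ENNReal.toReal_one] at this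
  have main := lintegral_rpow_lintegral_sub_mul_le (μ := μ) hf.enorm hk.enorm hp1 hr1
    (by linarith) hreal
  rw [eLpNorm_eq_lintegral_rpow_enorm_toReal (ne0 ha) ha',
    eLpNorm_eq_lintegral_rpow_enorm_toReal (ne0 hp) hp',
    eLpNorm_eq_lintegral_rpow_enorm_toReal (ne0 hr) hr']
  simp only [enorm_eq_self]
  refine (ENNReal.rpow_le_rpow main (by positivity)).trans (le_of_eq ?_)
  rw [ENNReal.mul_rpow_of_nonneg _ _ (by positivity), ← ENNReal.rpow_mul, ← ENNReal.rpow_mul]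
  congr 2 <;> field_simp

end Young

/-! ### Bounded operators with a convolution kernel in `L^r`. -/

section KernelOperator

variable {n : ℕ}

local notation "E" => EuclideanSpace ℝ (Fin n)

/-- `y ↦ Φ(y) ∫ k(x - y) χ(x) f(x) dx`. -/
noncomputable def kernelOp (k Φ χ f : EuclideanSpace ℝ (Fin n) → ℂ) :
    EuclideanSpace ℝ (Fin n) → ℂ :=
  fun y => Φ y * ∫ x, k (x - y) * (χ x * f x)

theorem aestronglyMeasurable_sub_mul {k g : E → ℂ} (hk : Measurable k)
    (hg : AEStronglyMeasurable g volume) :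
    AEStronglyMeasurable (fun z : E × E => k (z.2 - z.1) * g z.2) (volume.prod volume) :=
  (hk.comp (measurable_snd.sub measurable_fst)).aestronglyMeasurable.mul hg.comp_snd

theorem eLpNorm_mul_le_top_mul {p : ℝ≥0∞} {χ f : E → ℂ}
    (hf : AEStronglyMeasurable f volume) :
    eLpNorm (fun x => χ x * f x) p volume ≤ eLpNorm χ ⊤ volume * eLpNorm f p volume :=
  eLpNorm_smul_le_eLpNorm_top_mul_eLpNorm p hf χ

variable {p r a : ℝ≥0∞} {k Φ χ : EuclideanSpace ℝ (Fin n) → ℂ}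

theorem eLpNorm_lintegral_kernel_le (hk : Measurable k) (hχ : AEStronglyMeasurable χ volume)
    (hp : 1 ≤ p) (hr : 1 ≤ r) (ha : 1 ≤ a)
    (hp' : p ≠ ⊤) (hr' : r ≠ ⊤) (ha' : a ≠ ⊤) (h : 1 + a⁻¹ = p⁻¹ + r⁻¹)
    {f : E → ℂ} (hf : AEStronglyMeasurable f volume) :
    eLpNorm (fun y => ∫⁻ x, ‖k (x - y)‖ₑ * ‖χ x * f x‖ₑ) a volume ≤
      eLpNorm k r volume * (eLpNorm χ ⊤ volume * eLpNorm f p volume) :=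
  (eLpNorm_lintegral_sub_mul_le (hχ.mul hf) hk hp hr ha hp' hr' ha' h).trans
    (mul_le_mul_right (eLpNorm_mul_le_top_mul hf) _)

theorem eLpNorm_kernelOp_le (hk : Measurable k)
    (hχ : AEStronglyMeasurable χ volume)
    (hp : 1 ≤ p) (hr : 1 ≤ r) (ha : 1 ≤ a)
    (hp' : p ≠ ⊤) (hr' : r ≠ ⊤) (ha' : a ≠ ⊤) (h : 1 + a⁻¹ = p⁻¹ + r⁻¹)
    {f : E → ℂ} (hf : AEStronglyMeasurable f volume) :
    eLpNorm (kernelOp k Φ χ f) a volume ≤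
      eLpNorm Φ ⊤ volume * (eLpNorm k r volume * (eLpNorm χ ⊤ volume * eLpNorm f p volume)) := by
  have hm : AEStronglyMeasurable (fun y => ∫ x, k (x - y) * (χ x * f x)) volume :=
    (aestronglyMeasurable_sub_mul hk (hχ.mul hf)).integral_prod_right'
  refine (eLpNorm_mul_le_top_mul hm).trans (mul_le_mul_right ?_ _)
  refine le_trans ?_ (eLpNorm_lintegral_kernel_le hk hχ hp hr ha hp' hr' ha' h hf)
  refine eLpNorm_mono_enorm fun y => ?_
  rw [enorm_eq_self]
  refine (enorm_integral_le_lintegral_enorm _).trans (le_of_eq (lintegral_congr fun x => ?_))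
  rw [enorm_mul]

/-- Finiteness of the `L^a` norm in Young's inequality makes the inner integral of absolute values
finite almost everywhere. This is what makes the Bochner-integral operator additive. -/
theorem ae_integrable_kernel (hk : Measurable k) (hkr : eLpNorm k r volume ≠ ⊤)
    (hχ : MemLp χ ⊤ volume) (hp : 1 ≤ p) (hr : 1 ≤ r) (ha : 1 ≤ a)
    (hp' : p ≠ ⊤) (hr' : r ≠ ⊤) (ha' : a ≠ ⊤) (h : 1 + a⁻¹ = p⁻¹ + r⁻¹)
    {f : E → ℂ} (hf : MemLp f p volume) :
    ∀ᵐ y : E, Integrable (fun x => k (x - y) * (χ x * f x)) := by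
  have hb := eLpNorm_lintegral_kernel_le hk hχ.1 hp hr ha hp' hr' ha' h hf.1
  have hfin : eLpNorm (fun y => ∫⁻ x, ‖k (x - y)‖ₑ * ‖χ x * f x‖ₑ) a volume < ⊤ :=
    hb.trans_lt (ENNReal.mul_lt_top hkr.lt_top (ENNReal.mul_lt_top hχ.2 hf.2))
  have ha0 : a ≠ 0 := (zero_lt_one.trans_le ha).ne'
  have hlt := (eLpNorm_lt_top_iff_lintegral_rpow_enorm_lt_top ha0 ha').1 hfin
  simp only [enorm_eq_self] at hlt
  have hm : AEMeasurable (fun y => ∫⁻ x, ‖k (x - y)‖ₑ * ‖χ x * f x‖ₑ) volume := by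
    have := (aestronglyMeasurable_sub_mul hk (hχ.1.mul hf.1)).enorm.lintegral_prod_right'
    simpa only [enorm_mul, Pi.mul_apply] using this
  have hae := ae_lt_top' (hm.pow_const a.toReal) hlt.ne
  have hapos : 0 < a.toReal := ENNReal.toReal_pos ha0 ha'
  filter_upwards [hae] with y hy
  refine ⟨((hk.comp (measurable_id.sub_const y)).aestronglyMeasurable).mul (hχ.1.mul hf.1), ?_⟩
  rw [hasFiniteIntegral_iff_enorm]
  have := (ENNReal.rpow_lt_top_iff_of_pos hapos).1 hy
  simpa only [enorm_mul] using this

/-- The integral operator with a convolution kernel in `L^r`, as a bounded operator. -/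
theorem exists_clm_eq_kernelOp (hk : Measurable k) (hkr : eLpNorm k r volume ≠ ⊤)
    (hΦ : MemLp Φ ⊤ volume) (hχ : MemLp χ ⊤ volume) [hp : Fact (1 ≤ p)] (hr : 1 ≤ r)
    [ha : Fact (1 ≤ a)]
    (hp' : p ≠ ⊤) (hr' : r ≠ ⊤) (ha' : a ≠ ⊤) (h : 1 + a⁻¹ = p⁻¹ + r⁻¹) :
    ∃ T : Lp ℂ p (volume : Measure E) →L[ℂ] Lp ℂ a (volume : Measure E),
      (∀ f, T f =ᵐ[volume] kernelOp k Φ χ f) ∧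
      ‖T‖ ≤ (eLpNorm k r volume).toReal * supNorm Φ * supNorm χ := by
  have hbound : ∀ f : Lp ℂ p (volume : Measure E), eLpNorm (kernelOp k Φ χ f) a volume ≤
      eLpNorm Φ ⊤ volume * (eLpNorm k r volume * (eLpNorm χ ⊤ volume * eLpNorm f p volume)) :=
    fun f => eLpNorm_kernelOp_le hk hχ.1 hp.out hr ha.out hp' hr' ha' h (Lp.memLp f).1
  have hfin : ∀ f : Lp ℂ p (volume : Measure E),
      eLpNorm Φ ⊤ volume * (eLpNorm k r volume * (eLpNorm χ ⊤ volume * eLpNorm f p volume)) < ⊤ :=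
    fun f => ENNReal.mul_lt_top hΦ.2 (ENNReal.mul_lt_top hkr.lt_top
      (ENNReal.mul_lt_top hχ.2 (Lp.memLp f).2))
  have hmem : ∀ f : Lp ℂ p (volume : Measure E), MemLp (kernelOp k Φ χ f) a volume := fun f =>
    ⟨hΦ.1.mul (aestronglyMeasurable_sub_mul hk (hχ.1.mul (Lp.memLp f).1)).integral_prod_right',
      (hbound f).trans_lt (hfin f)⟩
  have hint : ∀ f : Lp ℂ p (volume : Measure E),
      ∀ᵐ y : E, Integrable (fun x => k (x - y) * (χ x * f x)) := fun f =>
    ae_integrable_kernel hk hkr hχ hp.out hr ha.out hp' hr' ha' h (Lp.memLp f)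
  let T₀ : Lp ℂ p (volume : Measure E) →ₗ[ℂ] Lp ℂ a (volume : Measure E) :=
    { toFun := fun f => (hmem f).toLp _
      map_add' := by
        intro f g
        rw [← MemLp.toLp_add, MemLp.toLp_eq_toLp_iff]
        filter_upwards [hint f, hint g] with y hf hg
        simp only [kernelOp, Pi.add_apply]
        rw [← mul_add, ← integral_add hf hg]
        congr 1
        refine integral_congr_ae ?_
        filter_upwards [Lp.coeFn_add f g] with x hx
        rw [hx, Pi.add_apply]; ring
      map_smul' := by
        intro c f
        rw [RingHom.id_apply, ← MemLp.toLp_const_smul, MemLp.toLp_eq_toLp_iff]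
        refine Filter.Eventually.of_forall fun y => ?_
        simp only [kernelOp, Pi.smul_apply, smul_eq_mul]
        have : ∫ x, k (x - y) * (χ x * (c • f) x) = c * ∫ x, k (x - y) * (χ x * f x) := by
          rw [← integral_const_mul]
          refine integral_congr_ae ?_
          filter_upwards [Lp.coeFn_smul c f] with x hx
          rw [hx, Pi.smul_apply, smul_eq_mul]; ring
        rw [this]; ring }
  refine ⟨T₀.mkContinuous ((eLpNorm k r volume).toReal * supNorm Φ * supNorm χ) ?_,
    fun f => (hmem f).coeFn_toLp, LinearMap.mkContinuous_norm_le _ (by unfold supNorm; positivity) _⟩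
  intro f
  show ‖(hmem f).toLp _‖ ≤ _
  rw [Lp.norm_toLp, Lp.norm_def]
  refine (ENNReal.toReal_mono (hfin f).ne (hbound f)).trans (le_of_eq ?_)
  simp only [ENNReal.toReal_mul, supNorm]
  ring

/-- The absolute convergence behind transposing a kernel operator. -/
theorem integrable_kernel_pairing (hk : Measurable k) (hkr : eLpNorm k r volume ≠ ⊤)
    (hχ : MemLp χ ⊤ volume) (hp : 1 ≤ p) (hr : 1 ≤ r)
    (ha : 1 ≤ a) (hp' : p ≠ ⊤) (hr' : r ≠ ⊤) (ha' : a ≠ ⊤) (h : 1 + a⁻¹ = p⁻¹ + r⁻¹)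
    {b : ℝ≥0∞} (hb' : b ≠ ⊤) (hab : b⁻¹ + a⁻¹ = 1) {f u : E → ℂ} (hf : MemLp f p volume)
    (hu : MemLp u b volume) :
    Integrable (fun z : E × E => k (z.2 - z.1) * (χ z.2 * f z.2) * u z.1)
      (volume.prod volume) := by
  have hm := aestronglyMeasurable_sub_mul hk (hχ.1.mul hf.1)
  have hm2 : AEStronglyMeasurable
      (fun z : E × E => k (z.2 - z.1) * (χ z.2 * f z.2) * u z.1) (volume.prod volume) :=
    hm.mul hu.1.comp_fst
  refine ⟨hm2, ?_⟩
  have hb := eLpNorm_lintegral_kernel_le hk hχ.1 hp hr ha hp' hr' ha' h hf.1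
  rw [hasFiniteIntegral_iff_enorm, lintegral_prod _ hm2.enorm]
  have hm1 : AEMeasurable (fun y => ∫⁻ x, ‖k (x - y)‖ₑ * ‖χ x * f x‖ₑ) volume := by
    simpa only [enorm_mul, Pi.mul_apply] using hm.enorm.lintegral_prod_right'
  have : ENNReal.HolderConjugate b a := by
    rw [ENNReal.holderConjugate_iff]; exact hab
  have hconj := ENNReal.HolderConjugate.toReal_of_ne_top hb' ha' (p := b) (q := a)
  have hol := ENNReal.lintegral_mul_le_Lp_mul_Lq volume hconj hu.1.enorm hm1
  have hfin : eLpNorm (fun y => ∫⁻ x, ‖k (x - y)‖ₑ * ‖χ x * f x‖ₑ) a volume < ⊤ :=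
    hb.trans_lt (ENNReal.mul_lt_top hkr.lt_top (ENNReal.mul_lt_top hχ.2 hf.2))
  have hu2 := hu.2
  have ha0 : a ≠ 0 := (zero_lt_one.trans_le ha).ne'
  have hb0 : b ≠ 0 := by
    rintro rfl
    simp at hab
  rw [eLpNorm_eq_lintegral_rpow_enorm_toReal ha0 ha'] at hfin
  rw [eLpNorm_eq_lintegral_rpow_enorm_toReal hb0 hb'] at hu2
  simp only [enorm_eq_self] at hfin
  refine lt_of_le_of_lt (le_trans (le_of_eq (lintegral_congr fun y => ?_)) hol)
    (ENNReal.mul_lt_top hu2 hfin)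
  simp only [enorm_mul, Pi.mul_apply]
  rw [lintegral_mul_const' _ _ enorm_ne_top, mul_comm]

end KernelOperator

/-! ### Cauchy estimates for derivatives of the Gaussian. -/

section GaussianDerivatives

/-- The `k`-th complex derivative of `z ↦ exp (-z²)`. -/
noncomputable def gaussDeriv (k : ℕ) : ℂ → ℂ := iteratedDeriv k fun z => Complex.exp (-z ^ 2)

theorem contDiff_cexp_neg_sq {m : WithTop ℕ∞} : ContDiff ℂ m fun z : ℂ => Complex.exp (-z ^ 2) := by
  fun_prop

theorem hasDerivAt_gaussDeriv (k : ℕ) (z : ℂ) :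
    HasDerivAt (gaussDeriv k) (gaussDeriv (k + 1) z) z := by
  unfold gaussDeriv
  rw [iteratedDeriv_succ]
  exact ((contDiff_cexp_neg_sq (m := ω)).differentiable_iteratedDeriv k
    (WithTop.coe_lt_top _) z).hasDerivAt

theorem continuous_gaussDeriv (k : ℕ) : Continuous (gaussDeriv k) :=
  continuous_iff_continuousAt.2 fun z => (hasDerivAt_gaussDeriv k z).continuousAt

theorem gaussDeriv_zero (z : ℂ) : gaussDeriv 0 z = Complex.exp (-z ^ 2) := by
  simp [gaussDeriv]

/-- Cauchy's estimate on the circle of radius `ρ` about `x`. With `z = x + a + ib`, the inequality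
`(x + a)² ≥ x²/2 - a²` gives `Re(-z²) ≤ a² + b² - x²/2`, well within the stated exponent. -/
theorem norm_gaussDeriv_le (k : ℕ) (x : ℝ) {ρ : ℝ} (hρ : 0 < ρ) :
    ‖gaussDeriv k x‖ ≤ k ! * Real.exp (3 * ρ ^ 2 - x ^ 2 / 2) / ρ ^ k := by
  refine Complex.norm_iteratedDeriv_le_of_forall_mem_sphere_norm_le k hρ
    (contDiff_cexp_neg_sq (m := 1)).differentiable_one.diffContOnCl fun z hz => ?_
  rw [Complex.norm_exp, Real.exp_le_exp]
  rw [mem_sphere_iff_norm, ← sq_eq_sq₀ (norm_nonneg _) hρ.le, Complex.sq_norm,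
    Complex.normSq_apply] at hz
  simp only [Complex.sub_re, Complex.ofReal_re, Complex.sub_im, Complex.ofReal_im, sub_zero] at hz
  simp only [Complex.neg_re, sq, Complex.mul_re]
  nlinarith [sq_nonneg (x + 2 * (z.re - x)), sq_nonneg (z.re - x), sq_nonneg z.im]

/-- A derivative of positive order does not see constants, so Cauchy's estimate applies to `exp(-z²)
- 1`, which is of size `2|z|²` on the unit disc. This quadratic smallness yields the long-time gain.
-/
theorem norm_gaussDeriv_le_of_pos {k : ℕ} (hk : 0 < k) (x : ℝ) {ρ : ℝ} (hρ : 0 < ρ)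
    (hx : |x| + ρ ≤ 1) :
    ‖gaussDeriv k x‖ ≤ k ! * (2 * (|x| + ρ) ^ 2) / ρ ^ k := by
  have : gaussDeriv k x = iteratedDeriv k (fun z => -1 + Complex.exp (-z ^ 2)) x := by
    rw [iteratedDeriv_const_add hk, gaussDeriv]
  rw [this]
  have hc : ContDiff ℂ 1 fun z : ℂ => -1 + Complex.exp (-z ^ 2) := by fun_prop
  refine Complex.norm_iteratedDeriv_le_of_forall_mem_sphere_norm_le k hρ
    hc.differentiable_one.diffContOnCl fun z hz => ?_
  have hz' : ‖z‖ ≤ |x| + ρ := by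
    rw [mem_sphere_iff_norm] at hz
    calc ‖z‖ = ‖(x : ℂ) + (z - x)‖ := by congr 1; ring
      _ ≤ _ := (norm_add_le _ _).trans (by rw [hz, Complex.norm_real, Real.norm_eq_abs])
  have hz2 : ‖-z ^ 2‖ ≤ (|x| + ρ) ^ 2 := by
    rw [norm_neg, norm_pow]
    gcongr
  have h1 : (|x| + ρ) ^ 2 ≤ 1 := pow_le_one₀ (by positivity) hx
  rw [neg_add_eq_sub]
  exact (Complex.norm_exp_sub_one_le (hz2.trans h1)).trans (by linarith)

variable {n : ℕ}

local notation "E" => EuclideanSpace ℝ (Fin n)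

theorem prod_factorial_mul_div_pow (β : Fin n → ℕ) (M : Fin n → ℝ) (ρ : ℝ) :
    ∏ i, ((β i)! * M i / ρ ^ β i) = ((∏ i, (β i)! : ℕ) : ℝ) * (∏ i, M i) / ρ ^ ∑ i, β i := by
  rw [Finset.prod_div_distrib, Finset.prod_mul_distrib, Finset.prod_pow_eq_pow_sum]
  push_cast
  rfl

/-- One radius `ρ = ‖X‖/(2n+2)` serves all coordinates: `12n ≤ (2n+2)²` makes the total loss `3nρ²`
at most `‖X‖²/4`, leaving half of the Gaussian exponent `‖X‖²/2`. -/
theorem norm_prod_gaussDeriv_le_exp (hn : 1 ≤ n) (β : Fin n → ℕ) {X : E} (hX : X ≠ 0) :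
    ‖∏ i, gaussDeriv (β i) (X i)‖ ≤
      ((∏ i, (β i)! : ℕ) : ℝ) * Real.exp (-(‖X‖ ^ 2 / 4)) /
        (‖X‖ / (2 * n + 2)) ^ ∑ i, β i := by
  have hX0 : 0 < ‖X‖ := norm_pos_iff.2 hX
  set ρ := ‖X‖ / (2 * n + 2) with hρ
  have hρ0 : 0 < ρ := by positivity
  rw [norm_prod]
  refine (Finset.prod_le_prod (fun _ _ => norm_nonneg _)
    fun i _ => norm_gaussDeriv_le (β i) (X i) hρ0).trans ?_
  rw [prod_factorial_mul_div_pow, ← Real.exp_sum]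
  have hsum : ∑ i, (3 * ρ ^ 2 - X i ^ 2 / 2) = n * (3 * ρ ^ 2) - ‖X‖ ^ 2 / 2 := by
    rw [Finset.sum_sub_distrib, ← Finset.sum_div, EuclideanSpace.real_norm_sq_eq]
    simp
  rw [hsum]
  gcongr
  have hn' : (1 : ℝ) ≤ n := by exact_mod_cast hn
  have : n * (3 * ρ ^ 2) ≤ ‖X‖ ^ 2 / 4 := by
    rw [hρ, div_pow, ← mul_div_assoc, ← mul_div_assoc, div_le_div_iff₀ (by positivity) (by norm_num)]
    have h2 : (n : ℝ) * 3 * 4 ≤ (2 * n + 2) ^ 2 := by nlinarith [sq_nonneg ((n : ℝ) - 1)]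
    nlinarith [sq_nonneg ‖X‖]
  linarith

theorem norm_prod_gaussDeriv_le_sq (hn : 1 ≤ n) (β : Fin n → ℕ) (hβ : 0 < ∑ i, β i) {X : E}
    (hX : X ≠ 0) (hX1 : ‖X‖ ≤ 1 / 2) :
    ‖∏ i, gaussDeriv (β i) (X i)‖ ≤
      ((∏ i, (β i)! : ℕ) : ℝ) * (4 * ‖X‖ ^ 2 * Real.exp n) /
        (‖X‖ / (2 * n + 2)) ^ ∑ i, β i := by
  have hX0 : 0 < ‖X‖ := norm_pos_iff.2 hX
  have hn' : (1 : ℝ) ≤ n := by exact_mod_cast hn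
  set ρ := ‖X‖ / (2 * n + 2) with hρ
  have hρ0 : 0 < ρ := by positivity
  have hρ4 : ρ ≤ ‖X‖ / 4 := by
    rw [hρ]; gcongr; linarith
  obtain ⟨j, -, hj⟩ : ∃ j ∈ Finset.univ, 0 < β j := by
    by_contra! hcon
    exact absurd (Finset.sum_nonpos hcon) (by omega)
  have hXi : ∀ i, |X i| ≤ ‖X‖ := fun i => by
    simpa using PiLp.norm_apply_le X i
  -- A single coordinate `j` with `β j > 0` supplies the quadratic factor; the other coordinates are
  -- bounded crudely by `e`, for at most `exp n` altogether.
  let M : Fin n → ℝ := fun i => if i = j then 4 * ‖X‖ ^ 2 else Real.exp 1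
  have hM : ∀ i, ‖gaussDeriv (β i) (X i)‖ ≤ (β i)! * M i / ρ ^ β i := by
    intro i
    by_cases hij : i = j
    · subst hij
      refine (norm_gaussDeriv_le_of_pos hj (X i) hρ0 (by linarith [hXi i])).trans ?_
      simp only [M, if_true]
      have : (|X i| + ρ) ^ 2 ≤ (‖X‖ + ‖X‖ / 4) ^ 2 := by
        gcongr
        exact hXi i
      have h4 : 2 * (|X i| + ρ) ^ 2 ≤ 4 * ‖X‖ ^ 2 := by nlinarith
      exact div_le_div_of_nonneg_right (mul_le_mul_of_nonneg_left h4 (by positivity))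
        (by positivity)
    · refine (norm_gaussDeriv_le (β i) (X i) hρ0).trans ?_
      simp only [M, if_neg hij]
      gcongr
      nlinarith [sq_nonneg (X i)]
  rw [norm_prod]
  refine (Finset.prod_le_prod (fun _ _ => norm_nonneg _) fun i _ => hM i).trans ?_
  rw [prod_factorial_mul_div_pow]
  gcongr
  rw [← Finset.mul_prod_erase _ _ (Finset.mem_univ j)]
  have h1 : ∏ i ∈ Finset.univ.erase j, M i ≤ Real.exp n := by
    rw [Finset.prod_congr rfl (g := fun _ => Real.exp 1)
      (fun i hi => by simp [M, Finset.ne_of_mem_erase hi]), Finset.prod_const, ← Real.exp_nat_mul]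
    gcongr
    rw [Finset.card_erase_of_mem (Finset.mem_univ j), Finset.card_univ, Fintype.card_fin, mul_one]
    exact_mod_cast Nat.sub_le n 1
  simp only [M, if_true]
  gcongr

end GaussianDerivatives

/-! ### Pointwise and time-integrated bounds for derivatives of the heat kernel. -/

section HeatKernel

variable {n : ℕ}

local notation "E" => EuclideanSpace ℝ (Fin n)

/-- The derivative `D^β` of the heat kernel `(4πt)^{-n/2} exp (-‖x‖² / 4t)`. -/
noncomputable def heatDeriv (β : Fin n → ℕ) (t : ℝ) (x : EuclideanSpace ℝ (Fin n)) : ℂ :=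
  (((4 * Real.pi * t) ^ (-(n : ℝ) / 2) * ((2 * √t)⁻¹) ^ ∑ i, β i : ℝ) : ℂ) *
    ∏ i, gaussDeriv (β i) (((2 * √t)⁻¹ • x : E) i : ℝ)

theorem measurable_heatDeriv (β : Fin n → ℕ) :
    Measurable fun z : ℝ × E => heatDeriv β z.1 z.2 := by
  unfold heatDeriv
  refine Measurable.mul (by fun_prop) (Finset.measurable_prod _ fun i _ => ?_)
  refine (continuous_gaussDeriv _).measurable.comp (Complex.measurable_ofReal.comp ?_)
  simp only [PiLp.smul_apply, smul_eq_mul]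
  fun_prop

theorem continuous_heatDeriv (β : Fin n → ℕ) (t : ℝ) : Continuous (heatDeriv β t) := by
  unfold heatDeriv
  refine Continuous.mul (by fun_prop) (continuous_finsetProd _ fun i _ => ?_)
  refine (continuous_gaussDeriv _).comp (Complex.continuous_ofReal.comp ?_)
  simp only [PiLp.smul_apply, smul_eq_mul]
  fun_prop

theorem heatDeriv_zero {t : ℝ} (ht : 0 < t) (x : E) :
    heatDeriv 0 t x =
      (((4 * Real.pi * t) ^ (-(n : ℝ) / 2) * Real.exp (-(‖x‖ ^ 2 / (4 * t))) : ℝ) : ℂ) := by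
  unfold heatDeriv
  simp only [Pi.zero_apply, gaussDeriv_zero, ← Complex.exp_sum, Finset.sum_const_zero, pow_zero,
    mul_one]
  push_cast
  congr 2
  rw [← Complex.ofReal_pow, EuclideanSpace.real_norm_sq_eq, Finset.sum_neg_distrib]
  push_cast
  rw [Finset.sum_div]
  congr 1
  refine Finset.sum_congr rfl fun i _ => ?_
  simp only [PiLp.smul_apply, smul_eq_mul]
  push_cast
  have : ((√t : ℝ) : ℂ) ^ 2 = t := by
    rw [← Complex.ofReal_pow, Real.sq_sqrt ht.le]
  rw [mul_pow, inv_pow, mul_pow, this]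
  field_simp
  norm_num
  ring

theorem hasLineDerivAt_heatDeriv (β : Fin n → ℕ) (t : ℝ) (x : E) (i : Fin n) :
    HasLineDerivAt ℝ (heatDeriv β t) (heatDeriv (β + Pi.single i 1) t x) x
      (EuclideanSpace.single i 1) := by
  set c := (2 * √t)⁻¹ with hc
  have hγ : ∀ j ∈ Finset.univ.erase i, (β + Pi.single i 1 : Fin n → ℕ) j = β j := fun j hj => by
    simp [Finset.ne_of_mem_erase hj]
  have hsum : ∑ j, (β + Pi.single i 1 : Fin n → ℕ) j = ∑ j, β j + 1 := by
    simp [Finset.sum_add_distrib]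
  have hlin : ∀ τ : ℝ, heatDeriv β t (x + τ • EuclideanSpace.single i 1) =
      (((4 * Real.pi * t) ^ (-(n : ℝ) / 2) * c ^ ∑ i, β i : ℝ) : ℂ) *
        (gaussDeriv (β i) ((c * (x i + τ) : ℝ) : ℂ) *
          ∏ j ∈ Finset.univ.erase i, gaussDeriv (β j) ((c * x j : ℝ) : ℂ)) := by
    intro τ
    unfold heatDeriv
    rw [← Finset.mul_prod_erase _ _ (Finset.mem_univ i)]
    congr 2
    · simp [hc, mul_add]
    · refine Finset.prod_congr rfl fun j hj => ?_
      simp [hc, Finset.ne_of_mem_erase hj]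
  have hval : heatDeriv (β + Pi.single i 1) t x =
      (((4 * Real.pi * t) ^ (-(n : ℝ) / 2) * c ^ ∑ i, β i : ℝ) : ℂ) *
        (gaussDeriv (β i + 1) ((c * (x i + 0) : ℝ) : ℂ) * (c : ℂ) *
          ∏ j ∈ Finset.univ.erase i, gaussDeriv (β j) ((c * x j : ℝ) : ℂ)) := by
    unfold heatDeriv
    rw [← Finset.mul_prod_erase _ _ (Finset.mem_univ i), hsum, pow_succ,
      Finset.prod_congr rfl (fun j hj => by rw [hγ j hj])]
    simp only [Pi.add_apply, Pi.single_eq_same, PiLp.smul_apply, smul_eq_mul, add_zero, ← hc]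
    push_cast
    ring
  unfold HasLineDerivAt
  simp_rw [hlin]
  rw [hval]
  refine HasDerivAt.const_mul _ (HasDerivAt.mul_const ?_ _)
  have h1 : HasDerivAt (fun τ : ℝ => ((c * (x i + τ) : ℝ) : ℂ)) (c : ℂ) 0 := by
    have : HasDerivAt (fun τ : ℝ => c * (x i + τ)) c 0 := by
      simpa using ((hasDerivAt_id (0 : ℝ)).const_add (x i)).const_mul c
    exact this.ofReal_comp
  exact (hasDerivAt_gaussDeriv (β i) _).comp (0 : ℝ) h1

theorem norm_heatDeriv (β : Fin n → ℕ) {t : ℝ} (ht : 0 < t) (x : E) :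
    ‖heatDeriv β t x‖ = (4 * Real.pi * t) ^ (-(n : ℝ) / 2) * (((2 * √t)⁻¹) ^ (∑ i, β i) *
      ‖∏ i, gaussDeriv (β i) (((2 * √t)⁻¹ • x : E) i : ℝ)‖) := by
  rw [heatDeriv, norm_mul, Complex.norm_real, Real.norm_of_nonneg (by positivity), mul_assoc]

theorem four_pi_mul_rpow_le {t : ℝ} (ht : 0 < t) :
    (4 * Real.pi * t) ^ (-(n : ℝ) / 2) ≤ t ^ (-(n : ℝ) / 2) := by
  refine Real.rpow_le_rpow_of_nonpos ht ?_ (by rw [neg_div]; exact neg_nonpos.2 (by positivity))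
  nlinarith [Real.pi_gt_three]

/-- The chain-rule factor `c^k` cancels the same scale in the Cauchy radius, so `(N/‖x‖)^|β|`
appears without any power of `t`. -/
theorem inv_pow_mul_div_pow {c R N : ℝ} (hc : 0 < c) (k : ℕ) (A : ℝ) :
    c ^ k * (A / (c * R / N) ^ k) = A * (N / R) ^ k := by
  rw [mul_div_assoc, mul_pow, ← inv_div R N, inv_pow]
  field_simp

/-- Short times: the heat kernel derivative is controlled by its Gaussian decay. -/
theorem norm_heatDeriv_le_of_le_sq (hn : 1 ≤ n) (β : Fin n → ℕ) {t : ℝ} (ht : 0 < t) {x : E}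
    (htx : t ≤ ‖x‖ ^ 2) :
    ‖heatDeriv β t x‖ ≤ (n ! * 16 ^ n) * (((∏ i, (β i)! : ℕ) : ℝ) *
      ((2 * n + 2) / ‖x‖) ^ ∑ i, β i) * ‖x‖ ^ (-(n : ℝ)) := by
  have hx2 : 0 < ‖x‖ ^ 2 := ht.trans_le htx
  have hx0 : 0 < ‖x‖ := by
    rcases (norm_nonneg x).lt_or_eq with h | h
    · exact h
    · rw [← h] at hx2; simp at hx2
  have hc : 0 < (2 * √t)⁻¹ := by positivity
  have hcx : (2 * √t)⁻¹ • x ≠ 0 := smul_ne_zero hc.ne' (norm_pos_iff.1 hx0)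
  have hnorm : ‖(2 * √t)⁻¹ • x‖ = (2 * √t)⁻¹ * ‖x‖ := by
    rw [norm_smul, Real.norm_of_nonneg hc.le]
  rw [norm_heatDeriv β ht]
  have h1 := norm_prod_gaussDeriv_le_exp hn β hcx
  rw [hnorm] at h1
  have h2 := mul_le_mul_of_nonneg_left h1 (pow_nonneg hc.le (∑ i, β i))
  rw [inv_pow_mul_div_pow hc] at h2
  have hsq : ((2 * √t)⁻¹ * ‖x‖) ^ 2 / 4 = ‖x‖ ^ 2 / (16 * t) := by
    rw [mul_pow, inv_pow, mul_pow, Real.sq_sqrt ht.le]; field_simp; norm_num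
  rw [hsq] at h2
  set u := ‖x‖ ^ 2 / (16 * t) with hu
  have hu0 : 0 < u := by positivity
  -- From `exp u ≥ u^n/n!`. The power `n` exceeds the `n/2` needed to absorb `t^(-n/2)`; the surplus
  -- is harmless because `t ≤ ‖x‖²`.
  have hexp : Real.exp (-u) ≤ n ! * 16 ^ n * (t / ‖x‖ ^ 2) ^ n := by
    have := Real.pow_div_factorial_le_exp u hu0.le n
    rw [Real.exp_neg]
    have h3 : n ! * 16 ^ n * (t / ‖x‖ ^ 2) ^ n = (u ^ n / n !)⁻¹ := by
      rw [hu, inv_div, div_pow, div_pow, mul_pow]; field_simp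
    rw [h3]
    gcongr
  have htn : t ^ (-(n : ℝ) / 2) * (t / ‖x‖ ^ 2) ^ n ≤ ‖x‖ ^ (-(n : ℝ)) := by
    have e1 : (t / ‖x‖ ^ 2) ^ n = t ^ (n : ℝ) * ‖x‖ ^ (-(2 * n : ℝ)) := by
      rw [div_pow, Real.rpow_neg hx0.le, Real.rpow_natCast, div_eq_mul_inv, ← pow_mul,
        show (2 * (n : ℝ)) = ((2 * n : ℕ) : ℝ) by push_cast; ring, Real.rpow_natCast]
    have e2 : t ^ ((n : ℝ) / 2) ≤ ‖x‖ ^ (n : ℝ) := by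
      calc t ^ ((n : ℝ) / 2) ≤ (‖x‖ ^ 2) ^ ((n : ℝ) / 2) := by gcongr
        _ = ‖x‖ ^ (n : ℝ) := by
          rw [← Real.rpow_natCast, ← Real.rpow_mul hx0.le]; congr 1; push_cast; ring
    rw [e1, ← mul_assoc, ← Real.rpow_add ht, show -(n : ℝ) / 2 + n = n / 2 by ring,
      show -(n : ℝ) = n + -(2 * n) by ring, Real.rpow_add hx0]
    gcongr
  calc (4 * Real.pi * t) ^ (-(n : ℝ) / 2) * (((2 * √t)⁻¹) ^ (∑ i, β i) *
        ‖∏ i, gaussDeriv (β i) (((2 * √t)⁻¹ • x : E) i : ℝ)‖)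
      ≤ t ^ (-(n : ℝ) / 2) * (((∏ i, (β i)! : ℕ) : ℝ) * (n ! * 16 ^ n * (t / ‖x‖ ^ 2) ^ n) *
          ((2 * n + 2) / ‖x‖) ^ ∑ i, β i) := by
        refine mul_le_mul (four_pi_mul_rpow_le ht) (h2.trans ?_) (by positivity) (by positivity)
        gcongr
    _ = (n ! * 16 ^ n) * (((∏ i, (β i)! : ℕ) : ℝ) * ((2 * n + 2) / ‖x‖) ^ ∑ i, β i) *
          (t ^ (-(n : ℝ) / 2) * (t / ‖x‖ ^ 2) ^ n) := by ring
    _ ≤ _ := by gcongr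

/-- Long times: differentiating at least once gains a factor `‖x‖² / t`. -/
theorem norm_heatDeriv_le_of_sq_le (hn : 1 ≤ n) (β : Fin n → ℕ) (hβ : 0 < ∑ i, β i) {t : ℝ}
    {x : E} (hx : x ≠ 0) (htx : ‖x‖ ^ 2 ≤ t) :
    ‖heatDeriv β t x‖ ≤ Real.exp n * (((∏ i, (β i)! : ℕ) : ℝ) *
      ((2 * n + 2) / ‖x‖) ^ ∑ i, β i) * (‖x‖ ^ 2 * t ^ (-(n : ℝ) / 2 - 1)) := by
  have hx0 : 0 < ‖x‖ := norm_pos_iff.2 hx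
  have ht : 0 < t := (by positivity : 0 < ‖x‖ ^ 2).trans_le htx
  have hc : 0 < (2 * √t)⁻¹ := by positivity
  have hcx : (2 * √t)⁻¹ • x ≠ 0 := smul_ne_zero hc.ne' hx
  have hnorm : ‖(2 * √t)⁻¹ • x‖ = (2 * √t)⁻¹ * ‖x‖ := by
    rw [norm_smul, Real.norm_of_nonneg hc.le]
  have hle : ‖(2 * √t)⁻¹ • x‖ ≤ 1 / 2 := by
    have : ‖x‖ ≤ √t := Real.le_sqrt_of_sq_le htx
    rw [hnorm, inv_mul_le_iff₀ (by positivity)]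
    linarith
  rw [norm_heatDeriv β ht]
  have h1 := norm_prod_gaussDeriv_le_sq hn β hβ hcx hle
  rw [hnorm] at h1
  have h2 := mul_le_mul_of_nonneg_left h1 (pow_nonneg hc.le (∑ i, β i))
  rw [inv_pow_mul_div_pow hc] at h2
  have hsq : 4 * ((2 * √t)⁻¹ * ‖x‖) ^ 2 = ‖x‖ ^ 2 * t⁻¹ := by
    rw [mul_pow, inv_pow, mul_pow, Real.sq_sqrt ht.le]; field_simp; norm_num
  rw [hsq] at h2
  refine (mul_le_mul (four_pi_mul_rpow_le ht) h2 (by positivity) (by positivity)).trans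
    (le_of_eq ?_)
  rw [Real.rpow_sub ht, Real.rpow_one]
  ring

theorem setLIntegral_ofReal_rpow_Ioc {s a : ℝ} (hs : 0 < s) (ha : 0 < a) :
    ∫⁻ t in Set.Ioc 0 a, ENNReal.ofReal (t ^ (s - 1)) = ENNReal.ofReal (a ^ s / s) := by
  rw [← ofReal_integral_eq_lintegral_ofReal]
  · rw [← intervalIntegral.integral_of_le ha.le, integral_rpow (Or.inl (by linarith))]
    simp [Real.zero_rpow hs.ne']
  · exact (intervalIntegrable_iff_integrableOn_Ioc_of_le ha.le).1
      (intervalIntegral.intervalIntegrable_rpow' (by linarith))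
  · filter_upwards [ae_restrict_mem measurableSet_Ioc] with t ht
    exact Real.rpow_nonneg ht.1.le _

theorem setLIntegral_ofReal_rpow_Ioi {b a : ℝ} (hb : b < -1) (ha : 0 < a) :
    ∫⁻ t in Set.Ioi a, ENNReal.ofReal (t ^ b) = ENNReal.ofReal (-a ^ (b + 1) / (b + 1)) := by
  rw [← ofReal_integral_eq_lintegral_ofReal, integral_Ioi_rpow_of_lt hb ha]
  · exact integrableOn_Ioi_rpow_of_lt hb ha
  · filter_upwards [ae_restrict_mem measurableSet_Ioi] with t ht
    exact Real.rpow_nonneg (ha.trans ht).le _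

/-- The constant in the bound for the time integral of heat kernel derivatives. -/
noncomputable def heatConst (n : ℕ) (s : ℝ) : ℝ :=
  n ! * 16 ^ n / s + Real.exp n / (1 + n / 2 - s)

theorem heatConst_pos {s : ℝ} (hs0 : 0 < s) (hs1 : s < 1) : 0 < heatConst n s := by
  have : 0 < 1 + (n : ℝ) / 2 - s := by
    have : (0 : ℝ) ≤ n / 2 := by positivity
    linarith
  unfold heatConst
  positivity

/-- The integral is split at the parabolic scale `t = ‖x‖²`. Near zero the integrand is controlled
by `t^(s-1)`, integrable since `s > 0`; beyond the split by `t^(s-2-n/2)`, integrable since `s < 1 +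
n/2`. Both pieces scale like `‖x‖^(2s-n)` times the Cauchy factor. -/
theorem lintegral_heatDeriv_le (hn : 1 ≤ n) (β : Fin n → ℕ) (hβ : 0 < ∑ i, β i) {s C : ℝ}
    (hs0 : 0 < s) (hs1 : s < 1) (hC : 0 ≤ C) {w : ℝ → ℝ} (hw0 : ∀ t, 0 < t → 0 ≤ w t)
    (hw : ∀ t, 0 < t → w t ≤ C * t ^ (s - 1)) {x : E} (hx : x ≠ 0) :
    ∫⁻ t in Set.Ioi 0, ‖(w t : ℂ) * heatDeriv β t x‖ₑ ≤
      ENNReal.ofReal (C * heatConst n s * (((∏ i, (β i)! : ℕ) : ℝ) *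
        ((2 * n + 2) / ‖x‖) ^ ∑ i, β i) * ‖x‖ ^ (2 * s - n)) := by
  have hx0 : 0 < ‖x‖ := norm_pos_iff.2 hx
  have hx2 : 0 < ‖x‖ ^ 2 := by positivity
  have hns : 0 < 1 + (n : ℝ) / 2 - s := by
    have : (0 : ℝ) ≤ n / 2 := by positivity
    linarith
  set B := ((∏ i, (β i)! : ℕ) : ℝ) * ((2 * n + 2) / ‖x‖) ^ ∑ i, β i with hB
  have hB0 : 0 ≤ B := by positivity
  have hen : ∀ t, 0 < t → ∀ b, ‖heatDeriv β t x‖ ≤ b →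
      ‖(w t : ℂ) * heatDeriv β t x‖ₑ ≤ ENNReal.ofReal (C * t ^ (s - 1) * b) := by
    intro t ht b hb
    rw [← ofReal_norm, norm_mul, Complex.norm_real, Real.norm_of_nonneg (hw0 t ht)]
    exact ENNReal.ofReal_le_ofReal (mul_le_mul (hw t ht) hb (norm_nonneg _)
      (mul_nonneg hC (Real.rpow_nonneg ht.le _)))
  have h1 : ∫⁻ t in Set.Ioc 0 (‖x‖ ^ 2), ‖(w t : ℂ) * heatDeriv β t x‖ₑ ≤
      ENNReal.ofReal (C * (n ! * 16 ^ n) * B * ‖x‖ ^ (-(n : ℝ)) * ((‖x‖ ^ 2) ^ s / s)) := by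
    rw [ENNReal.ofReal_mul (by positivity), ← setLIntegral_ofReal_rpow_Ioc hs0 hx2,
      ← lintegral_const_mul' _ _ ENNReal.ofReal_ne_top]
    refine setLIntegral_mono' measurableSet_Ioc fun t ht => ?_
    refine (hen t ht.1 _ (norm_heatDeriv_le_of_le_sq hn β ht.1 ht.2)).trans (le_of_eq ?_)
    rw [← ENNReal.ofReal_mul (by positivity)]
    congr 1; ring
  have h2 : ∫⁻ t in Set.Ioi (‖x‖ ^ 2), ‖(w t : ℂ) * heatDeriv β t x‖ₑ ≤
      ENNReal.ofReal (C * Real.exp n * B * ‖x‖ ^ 2 *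
        (-(‖x‖ ^ 2) ^ (s - 2 - n / 2 + 1) / (s - 2 - n / 2 + 1))) := by
    rw [ENNReal.ofReal_mul (by positivity),
      ← setLIntegral_ofReal_rpow_Ioi (by linarith) hx2,
      ← lintegral_const_mul' _ _ ENNReal.ofReal_ne_top]
    refine setLIntegral_mono' measurableSet_Ioi fun t ht => ?_
    have ht0 : 0 < t := hx2.trans ht
    refine (hen t ht0 _ (norm_heatDeriv_le_of_sq_le hn β hβ hx (le_of_lt ht))).trans
      (le_of_eq ?_)
    rw [← ENNReal.ofReal_mul (by positivity)]
    congr 1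
    rw [show s - 2 - (n : ℝ) / 2 = (s - 1) + (-(n : ℝ) / 2 - 1) by ring, Real.rpow_add ht0]
    ring
  have hsq : ∀ b : ℝ, (‖x‖ ^ 2) ^ b = ‖x‖ ^ (2 * b) := fun b => by
    rw [← Real.rpow_natCast, ← Real.rpow_mul hx0.le]; norm_num
  rw [← Set.Ioc_union_Ioi_eq_Ioi hx2.le]
  refine (lintegral_union_le _ _ _).trans ((add_le_add h1 h2).trans (le_of_eq ?_))
  rw [← ENNReal.ofReal_add (by positivity)]
  · congr 1
    have e1 : ‖x‖ ^ (-(n : ℝ)) * (‖x‖ ^ 2) ^ s = ‖x‖ ^ (2 * s - n) := by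
      rw [hsq, ← Real.rpow_add hx0]; congr 1; ring
    have e2 : ‖x‖ ^ 2 * (‖x‖ ^ 2) ^ (s - 2 - n / 2 + 1) = ‖x‖ ^ (2 * s - n) := by
      rw [hsq, ← Real.rpow_natCast, ← Real.rpow_add hx0]; congr 1; push_cast; ring
    rw [show -(‖x‖ ^ 2) ^ (s - 2 - (n : ℝ) / 2 + 1) / (s - 2 - n / 2 + 1) =
      (‖x‖ ^ 2) ^ (s - 2 - (n : ℝ) / 2 + 1) / (1 + n / 2 - s) by
        rw [neg_div, ← div_neg]; congr 1; ring]
    unfold heatConst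
    linear_combination (C * (n ! * 16 ^ n) * B / s) * e1 +
      (C * Real.exp n * B / (1 + n / 2 - s)) * e2
  · refine mul_nonneg (by positivity) ?_
    rw [neg_div, ← div_neg]
    refine div_nonneg (by positivity) (by linarith)

end HeatKernel

/-! ### The `L^r` norm of the kernel away from the origin. -/

section KernelTail

variable {n : ℕ}

local notation "E" => EuclideanSpace ℝ (Fin n)

/-- The superposition `∫₀^∞ w(t) D^β h_t(x) dt` of heat kernel derivatives. -/
noncomputable def subordKernel (w : ℝ → ℝ) (β : Fin n → ℕ) (x : EuclideanSpace ℝ (Fin n)) : ℂ :=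
  ∫ t in Set.Ioi (0 : ℝ), (w t : ℂ) * heatDeriv β t x

/-- The kernel `subordKernel w β` cut off to `‖x‖ ≥ d`. -/
noncomputable def subordKernelTail (w : ℝ → ℝ) (β : Fin n → ℕ) (d : ℝ) :
    EuclideanSpace ℝ (Fin n) → ℂ :=
  Set.indicator {x | d ≤ ‖x‖} (subordKernel w β)

theorem measurable_subordKernelTail {w : ℝ → ℝ} (hw : Measurable w) (β : Fin n → ℕ) (d : ℝ) :
    Measurable (subordKernelTail w β d) := by
  refine Measurable.indicator ?_ (measurableSet_le measurable_const measurable_norm)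
  have h : StronglyMeasurable fun z : E × ℝ => (w z.2 : ℂ) * heatDeriv β z.2 z.1 := by
    refine Measurable.stronglyMeasurable ?_
    exact (Complex.measurable_ofReal.comp (hw.comp measurable_snd)).mul
      ((measurable_heatDeriv β).comp measurable_swap)
  exact h.integral_prod_right'.measurable

theorem norm_subordKernel_le (hn : 1 ≤ n) (β : Fin n → ℕ) (hβ : 0 < ∑ i, β i) {s C : ℝ}
    (hs0 : 0 < s) (hs1 : s < 1) (hC : 0 ≤ C) {w : ℝ → ℝ} (hw0 : ∀ t, 0 < t → 0 ≤ w t)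
    (hw : ∀ t, 0 < t → w t ≤ C * t ^ (s - 1)) {x : E} (hx : x ≠ 0) :
    ‖subordKernel w β x‖ ≤ C * heatConst n s * (((∏ i, (β i)! : ℕ) : ℝ) *
        ((2 * n + 2) / ‖x‖) ^ ∑ i, β i) * ‖x‖ ^ (2 * s - n) := by
  have hpos := heatConst_pos (n := n) hs0 hs1
  have h := (enorm_integral_le_lintegral_enorm _).trans
    (lintegral_heatDeriv_le hn β hβ hs0 hs1 hC hw0 hw hx)
  rw [← ofReal_norm] at h
  exact (ENNReal.ofReal_le_ofReal_iff (by positivity)).1 h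

theorem lintegral_comp_inv_smul {f : E → ℝ≥0∞} {d : ℝ} (hd : 0 < d) :
    ∫⁻ x, f (d⁻¹ • x) = ENNReal.ofReal (d ^ n) * ∫⁻ x, f x := by
  have hme : MeasurableEmbedding fun x : E => d⁻¹ • x :=
    (Homeomorph.smulOfNeZero d⁻¹ (inv_ne_zero hd.ne')).measurableEmbedding
  rw [← hme.lintegral_map, Measure.map_addHaar_smul _ (inv_ne_zero hd.ne'), lintegral_smul_measure]
  simp [abs_of_pos hd]

/-- The `L^r` norm of `(1 + ‖x‖)^{-(n + 2 - 2s)}` on `ℝⁿ`. -/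
noncomputable def bracketNorm (n : ℕ) (s : ℝ) (r : ℝ≥0∞) : ℝ :=
  (eLpNorm (fun x : EuclideanSpace ℝ (Fin n) => (1 + ‖x‖) ^ (-((n : ℝ) + 2 - 2 * s))) r
    volume).toReal

/-- Since `s < 1`, the decay exponent `n + 2 - 2s` exceeds `n`, so the profile is in `L^r` for every
finite `r ≥ 1`. -/
theorem eLpNorm_bracket_ne_top {s : ℝ} (hs1 : s < 1) {r : ℝ≥0∞} (hr1 : 1 ≤ r) (hr : r ≠ ⊤) :
    eLpNorm (fun x : E => (1 + ‖x‖) ^ (-((n : ℝ) + 2 - 2 * s))) r volume ≠ ⊤ := by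
  have hr0 : r ≠ 0 := (zero_lt_one.trans_le hr1).ne'
  have hrr : 1 ≤ r.toReal := by simpa using ENNReal.toReal_mono hr hr1
  refine ((eLpNorm_lt_top_iff_lintegral_rpow_enorm_lt_top hr0 hr).2 ?_).ne
  have hlt : ((Module.finrank ℝ E : ℕ) : ℝ) < ((n : ℝ) + 2 - 2 * s) * r.toReal := by
    rw [finrank_euclideanSpace_fin]
    have : (0 : ℝ) ≤ n := by positivity
    nlinarith
  refine lt_of_le_of_lt (le_of_eq (lintegral_congr fun x => ?_))
    (finite_integral_one_add_norm (μ := (volume : Measure E)) hlt)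
  rw [← ofReal_norm, Real.norm_of_nonneg (by positivity),
    ENNReal.ofReal_rpow_of_nonneg (by positivity) (by positivity),
    ← Real.rpow_mul (by positivity), neg_mul]

theorem eLpNorm_bracket_comp_inv_smul {s : ℝ} (hs1 : s < 1) {r : ℝ≥0∞} (hr1 : 1 ≤ r)
    (hr : r ≠ ⊤) {d : ℝ} (hd : 0 < d) :
    eLpNorm (fun x : E => (1 + ‖d⁻¹ • x‖) ^ (-((n : ℝ) + 2 - 2 * s))) r volume =
      ENNReal.ofReal (d ^ ((n : ℝ) / r.toReal) * bracketNorm n s r) := by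
  have hr0 : r ≠ 0 := (zero_lt_one.trans_le hr1).ne'
  have hfin := eLpNorm_bracket_ne_top (n := n) hs1 hr1 hr
  rw [ENNReal.ofReal_mul (by positivity), bracketNorm, ENNReal.ofReal_toReal hfin,
    eLpNorm_eq_lintegral_rpow_enorm_toReal hr0 hr,
    eLpNorm_eq_lintegral_rpow_enorm_toReal hr0 hr,
    lintegral_comp_inv_smul (f := fun x : E =>
      ‖(1 + ‖x‖) ^ (-((n : ℝ) + 2 - 2 * s))‖ₑ ^ r.toReal) hd,
    ENNReal.mul_rpow_of_nonneg _ _ (by positivity),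
    ENNReal.ofReal_rpow_of_nonneg (by positivity) (by positivity)]
  congr 2
  rw [← Real.rpow_natCast, ← Real.rpow_mul hd.le, mul_one_div]

/-- For `‖x‖ ≥ d` one has `‖x‖ ≥ (d + ‖x‖)/2 = (d/2)(1 + ‖x/d‖)`. -/
theorem norm_rpow_le_bracket {κ d : ℝ} (hκ : 0 ≤ κ) (hd : 0 < d) {x : E} (hx : d ≤ ‖x‖) :
    ‖x‖ ^ (-κ) ≤ (d / 2) ^ (-κ) * (1 + ‖d⁻¹ • x‖) ^ (-κ) := by
  rw [← Real.mul_rpow (by positivity) (by positivity)]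
  refine Real.rpow_le_rpow_of_nonpos (by positivity) ?_ (by linarith)
  rw [norm_smul, Real.norm_of_nonneg (by positivity)]
  field_simp
  linarith

/-- The constant in the `L^r` bound for `subordKernelTail`. -/
noncomputable def tailConst (n : ℕ) (s C : ℝ) (r : ℝ≥0∞) : ℝ :=
  C * heatConst n s * 2 ^ ((n : ℝ) + 2 - 2 * s) * (bracketNorm n s r + 1) *
    (2 * n + 2) ^ (2 * s - n * (1 - 1 / r.toReal))

/-- The 1 added to `bracketNorm` gives strict positivity without a lower bound on that norm. -/
theorem tailConst_pos {s C : ℝ} (hC : 0 < C) (hs0 : 0 < s) (hs1 : s < 1) (r : ℝ≥0∞) :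
    0 < tailConst n s C r := by
  have hpos := heatConst_pos (n := n) hs0 hs1
  have : 0 ≤ bracketNorm n s r := ENNReal.toReal_nonneg
  unfold tailConst
  positivity

theorem eLpNorm_subordKernelTail_le (hn : 1 ≤ n) (β : Fin n → ℕ) (hβ : 2 ≤ ∑ i, β i) {s C : ℝ}
    (hs0 : 0 < s) (hs1 : s < 1) (hC : 0 ≤ C) {w : ℝ → ℝ} (hw0 : ∀ t, 0 < t → 0 ≤ w t)
    (hw : ∀ t, 0 < t → w t ≤ C * t ^ (s - 1)) {r : ℝ≥0∞} (hr1 : 1 ≤ r) (hr : r ≠ ⊤) {d : ℝ}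
    (hd : 0 < d) :
    eLpNorm (subordKernelTail w β d) r volume ≤
      ENNReal.ofReal (tailConst n s C r * ((∏ i, (β i)! : ℕ) : ℝ) *
        ((2 * (n : ℝ) + 2) / d) ^
          (((∑ i, β i : ℕ) : ℝ) - 2 * s + (n : ℝ) * (1 - 1 / r.toReal))) := by
  have hpos := heatConst_pos (n := n) hs0 hs1
  have hbr : 0 ≤ bracketNorm n s r := ENNReal.toReal_nonneg
  set k := ∑ i, β i with hk
  set F := ((∏ i, (β i)! : ℕ) : ℝ) with hF
  set κ := (n : ℝ) + 2 - 2 * s with hκ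
  have hκ0 : 0 ≤ κ := by
    have : (0 : ℝ) ≤ n := by positivity
    rw [hκ]; linarith
  set N := 2 * (n : ℝ) + 2 with hN
  have hN0 : 0 < N := by positivity
  set A := C * heatConst n s * F * N ^ k * d ^ (-((k : ℝ) - 2)) * (d / 2) ^ (-κ) with hA
  have hA0 : 0 ≤ A := by positivity
  have hpt : ∀ x : E, ‖subordKernelTail w β d x‖ ≤ ‖A • (1 + ‖d⁻¹ • x‖) ^ (-κ)‖ := by
    intro x
    rw [smul_eq_mul, Real.norm_of_nonneg (by positivity)]
    by_cases hx : d ≤ ‖x‖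
    · have hx0 : 0 < ‖x‖ := hd.trans_le hx
      rw [subordKernelTail, Set.indicator_of_mem (by exact hx)]
      refine (norm_subordKernel_le hn β (by omega) hs0 hs1 hC hw0 hw (norm_pos_iff.1 hx0)).trans ?_
      -- The decay is split as `‖x‖^(-(k-2)) ‖x‖^(-κ)`. As `k ≥ 2`, the first factor can be frozen
      -- at `‖x‖ = d`; the remaining profile, and hence the constant, no longer depends on `β`.
      have e1 : (N / ‖x‖) ^ k * ‖x‖ ^ (2 * s - n) =
          N ^ k * ‖x‖ ^ (-((k : ℝ) - 2)) * ‖x‖ ^ (-κ) := by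
        rw [div_pow, ← Real.rpow_natCast ‖x‖, div_eq_mul_inv, ← Real.rpow_neg hx0.le, mul_assoc,
          mul_assoc, ← Real.rpow_add hx0, ← Real.rpow_add hx0]
        congr 2; rw [hκ]; ring
      have e2 : ‖x‖ ^ (-((k : ℝ) - 2)) ≤ d ^ (-((k : ℝ) - 2)) := by
        refine Real.rpow_le_rpow_of_nonpos hd hx ?_
        have : (2 : ℝ) ≤ k := by exact_mod_cast hβ
        linarith
      calc C * heatConst n s * (F * (N / ‖x‖) ^ k) * ‖x‖ ^ (2 * s - n)
          = C * heatConst n s * F * (N ^ k * ‖x‖ ^ (-((k : ℝ) - 2)) * ‖x‖ ^ (-κ)) := by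
            rw [← e1]; ring
        _ ≤ C * heatConst n s * F * (N ^ k * d ^ (-((k : ℝ) - 2)) *
              ((d / 2) ^ (-κ) * (1 + ‖d⁻¹ • x‖) ^ (-κ))) := by
            gcongr
            exact norm_rpow_le_bracket hκ0 hd hx
        _ = _ := by rw [hA]; ring
    · rw [subordKernelTail, Set.indicator_of_notMem (by exact hx), norm_zero]
      positivity
  refine (eLpNorm_mono hpt).trans ?_
  have := eLpNorm_const_smul A (fun x : E => (1 + ‖d⁻¹ • x‖) ^ (-κ)) r volume
  simp only [Pi.smul_def] at this
  rw [this, eLpNorm_bracket_comp_inv_smul hs1 hr1 hr hd, ← ofReal_norm,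
    Real.norm_of_nonneg hA0, ← ENNReal.ofReal_mul hA0]
  refine ENNReal.ofReal_le_ofReal ?_
  set e := (k : ℝ) - 2 * s + (n : ℝ) * (1 - 1 / r.toReal) with he
  have e3 : N ^ k = N ^ e * N ^ (2 * s - n * (1 - 1 / r.toReal)) := by
    rw [← Real.rpow_add hN0, ← Real.rpow_natCast]; congr 1; rw [he]; ring
  have e4 : d ^ (-((k : ℝ) - 2)) * (d / 2) ^ (-κ) * d ^ ((n : ℝ) / r.toReal) =
      2 ^ κ * d ^ (-e) := by
    rw [Real.div_rpow hd.le zero_le_two, Real.rpow_neg zero_le_two, div_inv_eq_mul,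
      show -e = -((k : ℝ) - 2) + -κ + n / r.toReal by rw [he, hκ]; ring, Real.rpow_add hd,
      Real.rpow_add hd]
    ring
  rw [Real.div_rpow hN0.le hd.le, div_eq_mul_inv (N ^ e), ← Real.rpow_neg hd.le]
  calc A * (d ^ ((n : ℝ) / r.toReal) * bracketNorm n s r)
      = C * heatConst n s * F * N ^ k * (d ^ (-((k : ℝ) - 2)) * (d / 2) ^ (-κ) *
          d ^ ((n : ℝ) / r.toReal)) * bracketNorm n s r := by rw [hA]; ring
    _ ≤ C * heatConst n s * F * N ^ k * (2 ^ κ * d ^ (-e)) * (bracketNorm n s r + 1) := by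
        rw [e4]; gcongr; linarith
    _ = _ := by rw [e3, tailConst]; ring

end KernelTail

/-! ### Fourier multipliers commute with derivatives. -/

section SymbolOp

open scoped SchwartzMap LineDeriv RealInnerProductSpace

variable {n : ℕ}

local notation "E" => EuclideanSpace ℝ (Fin n)

theorem partialDeriv_eq_fderiv {u : E → ℂ} (hu : ContDiff ℝ ∞ u) (i : Fin n) :
    partialDeriv i u = fun x => fderiv ℝ u x (EuclideanSpace.single i 1) := by
  ext x
  exact (hu.differentiable (by simp) x).lineDeriv_eq_fderiv

theorem contDiff_partialDeriv {u : E → ℂ} (hu : ContDiff ℝ ∞ u) (i : Fin n) :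
    ContDiff ℝ ∞ (partialDeriv i u) := by
  rw [partialDeriv_eq_fderiv hu]
  exact (hu.fderiv_right (m := ∞) (by simp)).clm_apply contDiff_const

theorem hasCompactSupport_partialDeriv {u : E → ℂ} (hs : HasCompactSupport u)
    (hu : ContDiff ℝ ∞ u) (i : Fin n) : HasCompactSupport (partialDeriv i u) := by
  rw [partialDeriv_eq_fderiv hu]
  exact hs.fderiv_apply ℝ _

theorem lineDeriv_fourierInv {g : E → ℂ} (hg : Integrable g)
    (hg' : Integrable fun ξ => ‖ξ‖ * ‖g ξ‖) (x v : E) :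
    lineDeriv ℝ (𝓕⁻ g) x v = 𝓕⁻ (fun ξ => (2 * Real.pi * Complex.I) * (⟪ξ, v⟫ : ℂ) * g ξ) x := by
  set h : E → ℂ := fun ξ => g (-ξ) with hh
  have hi : Integrable h := hg.comp_neg
  have hi' : Integrable fun ξ => ‖ξ‖ * ‖h ξ‖ := by
    simpa [hh] using hg'.comp_neg
  have hD := Real.hasFDerivAt_fourier hi hi' x
  rw [Real.fourierInv_eq_fourier_comp_neg, (hD.hasLineDerivAt v).lineDeriv, Real.fourierInv_eq_fourier_comp_neg]
  have hint : Integrable (VectorFourier.fourierSMulRight (innerSL ℝ) h) := by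
    refine (hi'.const_mul (2 * Real.pi * ‖(innerSL ℝ : E →L[ℝ] E →L[ℝ] ℝ)‖)).mono'
      hi.1.fourierSMulRight (Filter.Eventually.of_forall fun ξ => ?_)
    refine (VectorFourier.norm_fourierSMulRight_le (innerSL ℝ) h ξ).trans (le_of_eq (by ring))
  rw [Real.fourier_continuousLinearMap_apply hint]
  refine congrArg (fun g : E → ℂ => 𝓕 g x) (funext fun ξ => ?_)
  simp [hh, VectorFourier.fourierSMulRight_apply, innerSL_apply_apply ℝ]
  ring

theorem integrable_bounded_symbol_mul {σ : E → ℝ} (hσ : Measurable σ) {M : ℝ}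
    (hM : ∀ ξ, |σ ξ| ≤ M) {g : E → ℂ} (hg : Integrable g) :
    Integrable fun ξ => (σ ξ : ℂ) * g ξ :=
  hg.bdd_mul (Complex.measurable_ofReal.comp hσ).aestronglyMeasurable
    (Filter.Eventually.of_forall fun ξ => by simpa using hM ξ)

/-- On the Fourier side both operators are multiplications. The transform of a test function is
Schwartz and `σ` is bounded, so the first moment needed to differentiate under the inverse transform
is finite. -/
theorem partialDeriv_symbolOp {σ : E → ℝ} (hσ : Measurable σ) {M : ℝ} (hM : ∀ ξ, |σ ξ| ≤ M)
    {u : E → ℂ} (hu : ContDiff ℝ ∞ u) (hs : HasCompactSupport u) (i : Fin n) :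
    partialDeriv i (symbolOp σ u) = symbolOp σ (partialDeriv i u) := by
  set f : 𝓢(E, ℂ) := hs.toSchwartzMap hu with hf
  have hfu : (f : E → ℂ) = u := rfl
  set e : E := EuclideanSpace.single i 1
  have hpd : partialDeriv i u = (∂_{e} f : 𝓢(E, ℂ)) := by
    ext x
    rw [SchwartzMap.lineDerivOp_apply]
    rfl
  ext x
  have h1 : Integrable fun ξ => (σ ξ : ℂ) * 𝓕 u ξ := by
    rw [← hfu, ← SchwartzMap.fourier_coe]
    exact integrable_bounded_symbol_mul hσ hM (𝓕 f).integrable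
  have h2 : Integrable fun ξ => ‖ξ‖ * ‖(σ ξ : ℂ) * 𝓕 u ξ‖ := by
    have h3 := integrable_bounded_symbol_mul hσ hM
      (((𝓕 f).integrable_pow_mul volume 1).ofReal (𝕜 := ℂ))
    refine h3.norm.congr (Filter.Eventually.of_forall fun ξ => ?_)
    rw [← hfu, ← SchwartzMap.fourier_coe]
    simp
    ring
  show lineDeriv ℝ (𝓕⁻ fun ξ => (σ ξ : ℂ) * 𝓕 u ξ) x e = _
  rw [lineDeriv_fourierInv h1 h2, symbolOp, hpd, ← SchwartzMap.fourier_coe,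
    SchwartzMap.fourier_lineDerivOp_eq]
  refine congrArg (fun g : E → ℂ => 𝓕⁻ g x) (funext fun ξ => ?_)
  have ht : (fun ξ : E => ⟪ξ, e⟫).HasTemperateGrowth := by fun_prop
  rw [smul_apply, SchwartzMap.smulLeftCLM_apply_apply ht, SchwartzMap.fourier_coe, hfu]
  simp only [smul_eq_mul, Complex.real_smul]
  ring

/-- Smoothness and compact support are carried along with the commutation because each further
commutation requires them. -/
theorem foldr_partialDeriv_symbolOp {σ : E → ℝ} (hσ : Measurable σ) {M : ℝ}
    (hM : ∀ ξ, |σ ξ| ≤ M) (β : Fin n → ℕ) {u : E → ℂ} (hu : ContDiff ℝ ∞ u)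
    (hs : HasCompactSupport u) (l : List (Fin n)) :
    ContDiff ℝ ∞ (l.foldr (fun i v => (partialDeriv i)^[β i] v) u) ∧
    HasCompactSupport (l.foldr (fun i v => (partialDeriv i)^[β i] v) u) ∧
    l.foldr (fun i v => (partialDeriv i)^[β i] v) (symbolOp σ u) =
      symbolOp σ (l.foldr (fun i v => (partialDeriv i)^[β i] v) u) := by
  induction l with
  | nil => exact ⟨hu, hs, rfl⟩
  | cons i l ih =>
    simp only [List.foldr_cons]
    rw [ih.2.2]
    generalize l.foldr (fun i v => (partialDeriv i)^[β i] v) u = v at ih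
    obtain ⟨h1, h2, -⟩ := ih
    induction β i with
    | zero => exact ⟨h1, h2, rfl⟩
    | succ k ihk =>
      simp only [Function.iterate_succ_apply']
      rw [ihk.2.2]
      exact ⟨contDiff_partialDeriv ihk.1 i, hasCompactSupport_partialDeriv ihk.2.1 ihk.1 i,
        partialDeriv_symbolOp hσ hM ihk.1 ihk.2.1 i⟩

end SymbolOp

/-! ### Integration by parts against the heat kernel. -/

section Parts

variable {n : ℕ}

local notation "E" => EuclideanSpace ℝ (Fin n)

theorem integrable_heatDeriv_mul (γ : Fin n → ℕ) (t : ℝ) (x : E) {u : E → ℂ} (hu : Continuous u)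
    (hs : HasCompactSupport u) : Integrable fun y => heatDeriv γ t (x - y) * u y :=
  Continuous.integrable_of_hasCompactSupport
    (((continuous_heatDeriv γ t).comp (continuous_const.sub continuous_id)).mul hu) hs.mul_left

/-- The sign from integration by parts cancels the one from differentiating in `y` through `x - y`,
so no `(-1)^|β|` accumulates. -/
theorem integral_heatDeriv_mul_partialDeriv (γ : Fin n → ℕ) (t : ℝ) (x : E) (i : Fin n)
    {u : E → ℂ} (hu : ContDiff ℝ ∞ u) (hs : HasCompactSupport u) :
    ∫ y, heatDeriv γ t (x - y) * partialDeriv i u y =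
      ∫ y, heatDeriv (γ + Pi.single i 1) t (x - y) * u y := by
  have hf : ∀ y, HasLineDerivAt ℝ (fun y => heatDeriv γ t (x - y))
      (-heatDeriv (γ + Pi.single i 1) t (x - y)) y (EuclideanSpace.single i 1) := by
    intro y
    have h := hasLineDerivAt_heatDeriv γ t (x - y) i
    unfold HasLineDerivAt at h ⊢
    have h0 : HasDerivAt (fun τ : ℝ => -τ) (-1) 0 := hasDerivAt_neg 0
    rw [← neg_zero (G := ℝ)] at h
    have h2 := HasDerivAt.scomp (0 : ℝ) h h0
    simp only [neg_smul, one_smul] at h2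
    refine h2.congr_of_eventuallyEq (Filter.Eventually.of_forall fun τ => ?_)
    simp only [Function.comp_apply]
    congr 1
    module
  have hg : ∀ y, HasLineDerivAt ℝ u (partialDeriv i u y) y (EuclideanSpace.single i 1) :=
    fun y => (hu.differentiable (by simp) y).lineDifferentiableAt.hasLineDerivAt
  have key := integral_bilinear_hasLineDerivAt_right_eq_neg_left_of_integrable
    (μ := (volume : Measure E)) (B := ContinuousLinearMap.mul ℝ ℂ)
    (f := fun y => heatDeriv γ t (x - y)) (g := u)
    (f' := fun y => -heatDeriv (γ + Pi.single i 1) t (x - y)) (g' := partialDeriv i u)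
    (v := EuclideanSpace.single i 1) ?_ ?_ ?_ (fun y _ => hf y) (fun y _ => hg y)
  · simpa [integral_neg] using key
  · simpa using (integrable_heatDeriv_mul (γ + Pi.single i 1) t x hu.continuous hs).neg
  · exact integrable_heatDeriv_mul γ t x (contDiff_partialDeriv hu i).continuous (hasCompactSupport_partialDeriv hs hu i)
  · exact integrable_heatDeriv_mul γ t x hu.continuous hs

theorem integral_heatDeriv_mul_iterate_partialDeriv (γ : Fin n → ℕ) (t : ℝ) (x : E) (i : Fin n)
    (k : ℕ) {u : E → ℂ} (hu : ContDiff ℝ ∞ u) (hs : HasCompactSupport u) :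
    ∫ y, heatDeriv γ t (x - y) * (partialDeriv i)^[k] u y =
      ∫ y, heatDeriv (γ + Pi.single i k) t (x - y) * u y := by
  induction k generalizing u with
  | zero => simp
  | succ k ih =>
    simp only [Function.iterate_succ_apply]
    rw [ih (contDiff_partialDeriv hu i) (hasCompactSupport_partialDeriv hs hu i),
      integral_heatDeriv_mul_partialDeriv _ t x i hu hs, add_assoc, ← Pi.single_add]

theorem integral_heatDeriv_mul_foldr_partialDeriv (β γ : Fin n → ℕ) (t : ℝ) (x : E)
    {u : E → ℂ} (hu : ContDiff ℝ ∞ u) (hs : HasCompactSupport u) (l : List (Fin n)) :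
    ∫ y, heatDeriv γ t (x - y) * l.foldr (fun i v => (partialDeriv i)^[β i] v) u y =
      ∫ y, heatDeriv (γ + (l.map fun i => Pi.single i (β i)).sum) t (x - y) * u y := by
  induction l generalizing γ with
  | nil => simp
  | cons i l ih =>
    have hreg := foldr_partialDeriv_symbolOp (σ := fun _ => 0) measurable_const (M := 0)
      (by simp) β hu hs l
    simp only [List.foldr_cons, List.map_cons, List.sum_cons]
    rw [integral_heatDeriv_mul_iterate_partialDeriv γ t x i (β i) hreg.1 hreg.2.1, ih, add_assoc]

theorem integral_heatDeriv_zero_mul_multiDeriv (β : Fin n → ℕ) (t : ℝ) (x : E)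
    {u : E → ℂ} (hu : ContDiff ℝ ∞ u) (hs : HasCompactSupport u) :
    ∫ y, heatDeriv 0 t (x - y) * multiDeriv β u y = ∫ y, heatDeriv β t (x - y) * u y := by
  have h := integral_heatDeriv_mul_foldr_partialDeriv β 0 t x hu hs (List.finRange n)
  rwa [← Fin.sum_univ_def, Finset.univ_sum_single, zero_add] at h

end Parts

/-! ### Multipliers as superpositions of the heat semigroup. -/

section Subordination

open scoped RealInnerProductSpace

variable {n : ℕ}

local notation "E" => EuclideanSpace ℝ (Fin n)

/-- The symbol `σ` is the superposition `∫₀^∞ w(t) exp (-t (2π‖ξ‖)²) dt` of heat semigroup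
symbols, with a weight `0 ≤ w(t) ≤ C t^{s-1}`. -/
structure IsSubordinated (σ : EuclideanSpace ℝ (Fin n) → ℝ) (w : ℝ → ℝ) (s C : ℝ) : Prop where
  measurable_symbol : Measurable σ
  bounded : ∃ M, ∀ ξ, |σ ξ| ≤ M
  measurable_weight : Measurable w
  nonneg : ∀ t, 0 < t → 0 ≤ w t
  le : ∀ t, 0 < t → w t ≤ C * t ^ (s - 1)
  integrable : ∀ᵐ ξ : EuclideanSpace ℝ (Fin n),
    IntegrableOn (fun t => w t * Real.exp (-(t * (2 * Real.pi * ‖ξ‖) ^ 2))) (Set.Ioi 0)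
  integral_eq : ∀ᵐ ξ : EuclideanSpace ℝ (Fin n),
    ∫ t in Set.Ioi 0, w t * Real.exp (-(t * (2 * Real.pi * ‖ξ‖) ^ 2)) = σ ξ

/-- The multiplication formula `∫ û G = ∫ u Ĝ`, applied to the Gaussian modulated by `x`, whose
transform is the heat kernel centred at `x`. -/
theorem fourierInv_gaussian_mul_fourier {t : ℝ} (ht : 0 < t) {u : E → ℂ} (hu : Integrable u)
    (x : E) :
    𝓕⁻ (fun ξ => (Real.exp (-(t * (2 * Real.pi * ‖ξ‖) ^ 2)) : ℂ) * 𝓕 u ξ) x =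
      ∫ y, heatDeriv 0 t (x - y) * u y := by
  set b : ℝ := 4 * Real.pi ^ 2 * t with hb
  have hb0 : 0 < b := by positivity
  have hbre : 0 < (b : ℂ).re := by simpa using hb0
  set G : E → ℂ := fun ξ => Complex.exp (-(b : ℂ) * ‖ξ‖ ^ 2 + 2 * Real.pi * Complex.I * ⟪x, ξ⟫)
    with hG
  have hGint : Integrable G :=
    GaussianFourier.integrable_cexp_neg_mul_sq_norm_add hbre (2 * Real.pi * Complex.I) x
  have h1 : 𝓕⁻ (fun ξ => (Real.exp (-(t * (2 * Real.pi * ‖ξ‖) ^ 2)) : ℂ) * 𝓕 u ξ) x =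
      ∫ ξ, 𝓕 u ξ • G ξ := by
    rw [Real.fourierInv_eq']
    refine integral_congr_ae (Filter.Eventually.of_forall fun ξ => ?_)
    simp only [hG, smul_eq_mul, Complex.exp_add]
    rw [real_inner_comm]
    push_cast
    rw [hb]
    push_cast
    ring_nf
  have h2 : ∫ ξ, 𝓕 u ξ • G ξ = ∫ y, u y • 𝓕 G y := by
    simpa using! (VectorFourier.integral_fourierIntegral_smul_eq_flip (L := innerₗ E)
      Real.continuous_fourierChar continuous_inner hu hGint)
  rw [h1, h2]
  refine integral_congr_ae (Filter.Eventually.of_forall fun y => ?_)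
  simp only [smul_eq_mul]
  rw [mul_comm, hG, fourier_gaussian_innerProductSpace' hbre, heatDeriv_zero ht]
  congr 1
  have e1 : (Real.pi / b : ℂ) = ((4 * Real.pi * t)⁻¹ : ℝ) := by
    rw [hb]; push_cast
    have : (Real.pi : ℂ) ≠ 0 := by exact_mod_cast Real.pi_ne_zero
    have : (t : ℂ) ≠ 0 := by exact_mod_cast ht.ne'
    field_simp
  have e2 : ((Module.finrank ℝ E : ℂ) / 2) = (((n : ℝ) / 2 : ℝ) : ℂ) := by
    rw [finrank_euclideanSpace_fin]; push_cast; rfl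
  rw [e1, e2, ← Complex.ofReal_cpow (by positivity), Real.inv_rpow (by positivity),
    ← Real.rpow_neg (by positivity), neg_div]
  push_cast
  congr 2
  rw [hb]; push_cast
  have : (Real.pi : ℂ) ≠ 0 := by exact_mod_cast Real.pi_ne_zero
  field_simp

variable {σ : EuclideanSpace ℝ (Fin n) → ℝ} {w : ℝ → ℝ} {s C : ℝ}

theorem IsSubordinated.symbolOp_eq (h : IsSubordinated σ w s C) {u : E → ℂ}
    (hu : ContDiff ℝ ∞ u) (hs : HasCompactSupport u) (x : E) :
    symbolOp σ u x = ∫ t in Set.Ioi 0, (w t : ℂ) * ∫ y, heatDeriv 0 t (x - y) * u y := by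
  obtain ⟨M, hM⟩ := h.bounded
  have huint : Integrable u := hu.continuous.integrable_of_hasCompactSupport hs
  have hFint : Integrable (𝓕 u) := by
    have := (𝓕 (hs.toSchwartzMap hu)).integrable (μ := volume)
    rwa [SchwartzMap.fourier_coe] at this
  set g : E → ℝ → ℂ := fun ξ t =>
    ((w t * Real.exp (-(t * (2 * Real.pi * ‖ξ‖) ^ 2)) : ℝ) : ℂ) *
      (Complex.exp ((2 * Real.pi * ⟪ξ, x⟫ : ℝ) * Complex.I) * 𝓕 u ξ) with hg
  have hwm := h.measurable_weight
  have hFm : Continuous (𝓕 u) := by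
    have := (𝓕 (hs.toSchwartzMap hu)).continuous
    rwa [SchwartzMap.fourier_coe] at this
  have hmeas : AEStronglyMeasurable (Function.uncurry g)
      (volume.prod (volume.restrict (Set.Ioi (0 : ℝ)))) := by
    refine Measurable.aestronglyMeasurable ?_
    simp only [hg, Function.uncurry_def]
    refine Measurable.mul (Complex.measurable_ofReal.comp
      ((hwm.comp measurable_snd).mul (by fun_prop))) ?_
    refine Continuous.measurable ?_
    have := hFm.comp (continuous_fst (X := E) (Y := ℝ))
    fun_prop
  have hnorm : ∀ ξ, ∀ t ∈ Set.Ioi (0 : ℝ), ‖g ξ t‖ =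
      w t * Real.exp (-(t * (2 * Real.pi * ‖ξ‖) ^ 2)) * ‖𝓕 u ξ‖ := by
    intro ξ t ht
    simp only [hg]
    rw [norm_mul, norm_mul, Complex.norm_exp_ofReal_mul_I, one_mul, Complex.norm_real,
      Real.norm_of_nonneg (mul_nonneg (h.nonneg t ht) (Real.exp_pos _).le)]
  have hint : Integrable (Function.uncurry g)
      (volume.prod (volume.restrict (Set.Ioi (0 : ℝ)))) := by
    rw [integrable_prod_iff hmeas]
    constructor
    · filter_upwards [h.integrable] with ξ hξ
      have h3 : Integrable (fun t => ((w t * Real.exp (-(t * (2 * Real.pi * ‖ξ‖) ^ 2)) : ℝ) : ℂ))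
          (volume.restrict (Set.Ioi (0 : ℝ))) := hξ.ofReal
      exact h3.mul_const (Complex.exp ((2 * Real.pi * ⟪ξ, x⟫ : ℝ) * Complex.I) * 𝓕 u ξ)
    -- Since the weight is nonnegative, integrating `‖g ξ t‖` in `t` gives exactly `|σ(ξ)| ‖û(ξ)‖`.
    · refine (integrable_bounded_symbol_mul h.measurable_symbol hM hFint).norm.congr ?_
      filter_upwards [h.integral_eq] with ξ hξ
      simp only [Function.uncurry_apply_pair]
      rw [setIntegral_congr_fun measurableSet_Ioi (hnorm ξ), integral_mul_const, hξ, norm_mul,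
        Complex.norm_real, Real.norm_of_nonneg]
      rw [← hξ]
      exact setIntegral_nonneg measurableSet_Ioi fun t ht =>
        mul_nonneg (h.nonneg t ht) (Real.exp_pos _).le
  have h1 : symbolOp σ u x = ∫ ξ, ∫ t in Set.Ioi (0 : ℝ), g ξ t := by
    rw [symbolOp, Real.fourierInv_eq']
    refine integral_congr_ae ?_
    filter_upwards [h.integral_eq] with ξ hξ
    simp only [hg]
    rw [integral_mul_const, integral_complex_ofReal, hξ, smul_eq_mul]
    ring
  rw [h1, integral_integral_swap hint]
  refine setIntegral_congr_fun measurableSet_Ioi fun t ht => ?_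
  rw [← fourierInv_gaussian_mul_fourier ht huint x, Real.fourierInv_eq', ← integral_const_mul]
  refine integral_congr_ae (Filter.Eventually.of_forall fun ξ => ?_)
  simp only [hg, smul_eq_mul]
  push_cast
  ring

/-- The derivatives are moved onto the heat kernel at fixed `t`, before the integrals are exchanged.
The exchange is then justified because `u` vanishes within distance `d` of `x`, where the
time-integrated bound would be singular. -/
theorem IsSubordinated.multiDeriv_symbolOp_eq (h : IsSubordinated σ w s C) (hn : 1 ≤ n)
    (hs0 : 0 < s) (hs1 : s < 1) (hC : 0 ≤ C) (β : Fin n → ℕ) (hβ : 2 ≤ ∑ i, β i)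
    {u : E → ℂ} (hu : ContDiff ℝ ∞ u) (hs : HasCompactSupport u) {d : ℝ} (hd : 0 < d) {x : E}
    (hx : ∀ y, u y ≠ 0 → d ≤ ‖x - y‖) :
    multiDeriv β (symbolOp σ u) x = ∫ y, subordKernelTail w β d (x - y) * u y := by
  obtain ⟨M, hM⟩ := h.bounded
  have huint : Integrable u := hu.continuous.integrable_of_hasCompactSupport hs
  have hreg := foldr_partialDeriv_symbolOp h.measurable_symbol hM β hu hs (List.finRange n)
  have hcomm : multiDeriv β (symbolOp σ u) = symbolOp σ (multiDeriv β u) := hreg.2.2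
  have hdu : ContDiff ℝ ∞ (multiDeriv β u) := hreg.1
  have hds : HasCompactSupport (multiDeriv β u) := hreg.2.1
  rw [hcomm, h.symbolOp_eq hdu hds]
  simp_rw [integral_heatDeriv_zero_mul_multiDeriv β _ x hu hs, ← integral_const_mul]
  have hmeas : AEStronglyMeasurable
      (Function.uncurry fun (y : E) (t : ℝ) => (w t : ℂ) * (heatDeriv β t (x - y) * u y))
      (volume.prod (volume.restrict (Set.Ioi (0 : ℝ)))) := by
    refine Measurable.aestronglyMeasurable ?_
    simp only [Function.uncurry_def]
    have h1 := (measurable_heatDeriv β).comp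
      (measurable_snd.prodMk (measurable_const.sub measurable_fst) :
        Measurable fun z : E × ℝ => (z.2, x - z.1))
    exact (Complex.measurable_ofReal.comp (h.measurable_weight.comp measurable_snd)).mul
      (h1.mul (hu.continuous.measurable.comp measurable_fst))
  set F := ((∏ i, (β i)! : ℕ) : ℝ) with hF
  set k := ∑ i, β i with hk
  set B := C * heatConst n s * (F * (2 * n + 2) ^ k) * d ^ (2 * s - n - k) with hB
  have hpos := heatConst_pos (n := n) hs0 hs1
  have hint : Integrable
      (Function.uncurry fun (y : E) (t : ℝ) => (w t : ℂ) * (heatDeriv β t (x - y) * u y))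
      (volume.prod (volume.restrict (Set.Ioi (0 : ℝ)))) := by
    refine ⟨hmeas, ?_⟩
    rw [hasFiniteIntegral_iff_enorm, lintegral_prod _ hmeas.enorm]
    have hle : ∀ y, ∫⁻ t in Set.Ioi (0 : ℝ), ‖(w t : ℂ) * (heatDeriv β t (x - y) * u y)‖ₑ ≤
        ENNReal.ofReal B * ‖u y‖ₑ := by
      intro y
      by_cases huy : u y = 0
      · simp [huy]
      · have hdy := hx y huy
        have hz0 : 0 < ‖x - y‖ := hd.trans_le hdy
        simp_rw [← mul_assoc, enorm_mul _ (u y)]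
        rw [lintegral_mul_const' _ _ enorm_ne_top]
        gcongr
        refine (lintegral_heatDeriv_le hn β (by omega) hs0 hs1 hC h.nonneg h.le
          (norm_pos_iff.1 hz0)).trans (ENNReal.ofReal_le_ofReal ?_)
        have e1 : ((2 * (n : ℝ) + 2) / ‖x - y‖) ^ k * ‖x - y‖ ^ (2 * s - n) =
            (2 * (n : ℝ) + 2) ^ k * ‖x - y‖ ^ (2 * s - n - k) := by
          rw [Real.rpow_sub hz0 _ (k : ℝ), Real.rpow_natCast, div_pow]; ring
        have e2 : ‖x - y‖ ^ (2 * s - n - k) ≤ d ^ (2 * s - n - k) := by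
          refine Real.rpow_le_rpow_of_nonpos hd hdy ?_
          have : (2 : ℝ) ≤ k := by exact_mod_cast hβ
          have : (1 : ℝ) ≤ n := by exact_mod_cast hn
          linarith
        calc _ = C * heatConst n s * F *
              (((2 * (n : ℝ) + 2) / ‖x - y‖) ^ k * ‖x - y‖ ^ (2 * s - n)) := by ring
          _ ≤ C * heatConst n s * F * ((2 * (n : ℝ) + 2) ^ k * d ^ (2 * s - n - k)) := by
            rw [e1]; gcongr
          _ = B := by rw [hB]; ring
    refine (lintegral_mono hle).trans_lt ?_
    rw [lintegral_const_mul' _ _ ENNReal.ofReal_ne_top]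
    exact ENNReal.mul_lt_top ENNReal.ofReal_lt_top huint.2
  rw [← integral_integral_swap hint]
  refine integral_congr_ae (Filter.Eventually.of_forall fun y => ?_)
  simp only [← mul_assoc]
  rw [integral_mul_const]
  by_cases huy : u y = 0
  · simp [huy]
  · rw [subordKernelTail, Set.indicator_of_mem (by exact hx y huy), subordKernel]

end Subordination

/-! ### Identification with the distributional operator by duality. -/

section LocalizedOperator

variable {n : ℕ}

local notation "E" => EuclideanSpace ℝ (Fin n)

theorem IsSubordinated.exists_localizedOperator {σ : E → ℝ} {w : ℝ → ℝ} {s C : ℝ}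
    (h : IsSubordinated σ w s C) (hn : 1 ≤ n)
    (hs0 : 0 < s) (hs1 : s < 1) (hC : 0 < C) {β : Fin n → ℕ} (hβ : 2 ≤ ∑ i, β i)
    {p q q' r : ℝ≥0∞} [hp : Fact (1 ≤ p)] [hq' : Fact (1 ≤ q')] (hr1 : 1 ≤ r) (hr : r ≠ ⊤)
    (hp' : p ≠ ⊤) (hq1 : 1 < q) (hq : q ≠ ⊤) (hpqr : p⁻¹ + q⁻¹ + r⁻¹ = 2)
    (hqq : q⁻¹ + q'⁻¹ = 1) {Φ χ : E → ℂ} (hΦ : ContDiff ℝ ∞ Φ) (hΦb : MemLp Φ ∞ volume)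
    (hχb : MemLp χ ∞ volume) {d : ℝ} (hd : 0 < d)
    (hdist : ∀ x ∈ tsupport χ, ∀ y ∈ tsupport Φ, d ≤ dist x y) :
    ∃ T : Lp ℂ p (volume : Measure E) →L[ℂ] Lp ℂ q' (volume : Measure E),
      IsLocalizedOperator σ β Φ χ T ∧
      ‖T‖ ≤ smoothingBound (tailConst n s C r) s r β d Φ χ := by
  have hq't : q' ≠ ⊤ := by
    rintro rfl
    rw [ENNReal.inv_top, add_zero, ENNReal.inv_eq_one] at hqq
    exact hq1.ne' hqq
  have hyoung : 1 + q'⁻¹ = p⁻¹ + r⁻¹ := by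
    have hqi : q⁻¹ ≠ ⊤ := ENNReal.inv_ne_top.2 (zero_lt_one.trans hq1).ne'
    rw [← ENNReal.add_right_inj hqi, add_left_comm, hqq, one_add_one_eq_two, ← hpqr]
    ring
  set k := subordKernelTail w β d with hk
  have hkm : Measurable k := measurable_subordKernelTail h.measurable_weight β d
  have hkb := eLpNorm_subordKernelTail_le hn β hβ hs0 hs1 hC.le h.nonneg h.le hr1 hr hd
  have hkr : eLpNorm k r volume ≠ ⊤ := (hkb.trans_lt ENNReal.ofReal_lt_top).ne
  obtain ⟨T, hT, hTn⟩ := exists_clm_eq_kernelOp (p := p) (a := q') hkm hkr hΦb hχb hr1 hp' hr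
    hq't hyoung
  -- `T` is built from the transposed kernel `k(x - y)`, so the sign in the definition by
  -- transposition has to be restored; it does not affect the norm.
  refine ⟨(-1 : ℂ) ^ (∑ i, β i) • T, fun f => ?_, ?_⟩
  · intro ψ hψ hψs
    have hus : HasCompactSupport fun y => Φ y * ψ y := hψs.mul_left
    have hu : ContDiff ℝ ∞ fun y => Φ y * ψ y := hΦ.mul hψ
    have huq : MemLp (fun y => Φ y * ψ y) q volume :=
      hu.continuous.memLp_of_hasCompactSupport hus
    have hpair := integrable_kernel_pairing hkm hkr hχb hp.out hr1 hq'.out hp' hr hq't hyoung hq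
      hqq (Lp.memLp f) huq
    have heq : ∀ x, χ x * f x * multiDeriv β (symbolOp σ (fun y => Φ y * ψ y)) x =
        ∫ y, k (x - y) * (χ x * f x) * (Φ y * ψ y) := by
      intro x
      -- Where `χ x ≠ 0`, the point `x` is at distance at least `d` from the support of `Φψ`, so the
      -- truncated kernel represents the derivative exactly.
      by_cases hx : χ x = 0
      · simp [hx]
      · rw [h.multiDeriv_symbolOp_eq hn hs0 hs1 hC.le β hβ hu hus hd, ← integral_const_mul]
        · refine integral_congr_ae (Filter.Eventually.of_forall fun y => ?_)
          simp only [hk]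
          ring
        · intro y hy
          rw [← dist_eq_norm]
          exact hdist x (subset_tsupport _ hx) y (subset_tsupport _ (left_ne_zero_of_mul hy))
    simp only [heq]
    refine ⟨hpair.integral_prod_right, ?_⟩
    have hswap := integral_integral_swap (f := fun y x => k (x - y) * (χ x * f x) * (Φ y * ψ y))
      hpair
    rw [← hswap, ← integral_const_mul]
    refine integral_congr_ae ?_
    filter_upwards [hT f, Lp.coeFn_smul ((-1 : ℂ) ^ (∑ i, β i)) (T f)] with y hy hy'
    rw [smul_apply, hy', Pi.smul_apply, hy, kernelOp, integral_mul_const, smul_eq_mul]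
    ring
  · rw [norm_smul, norm_pow, norm_neg, norm_one, one_pow, one_mul]
    refine hTn.trans ?_
    have hbase : 0 ≤ tailConst n s C r := (tailConst_pos hC hs0 hs1 r).le
    have := ENNReal.toReal_mono ENNReal.ofReal_ne_top hkb
    rw [ENNReal.toReal_ofReal (by positivity)] at this
    unfold smoothingBound
    have hS : ∀ v : E → ℂ, 0 ≤ supNorm v := fun v => ENNReal.toReal_nonneg
    exact mul_le_mul_of_nonneg_right (mul_le_mul_of_nonneg_right this (hS Φ)) (hS χ)

end LocalizedOperator

/-! ### Subordination of the two concrete symbols. -/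

section Symbols

/-- Euler's integral `Γ(s) L^(-s) = ∫ t^(s-1) exp(-Lt) dt` at `L = (2π‖ξ‖)² + m²`; the weight bound
discards `exp(-m²t) ≤ 1`. -/
theorem isSubordinated_massiveSymbol (n : ℕ) {s m : ℝ} (hs : 0 < s) (hm : 0 < m) :
    IsSubordinated (massiveSymbol n s m)
      (fun t => t ^ (s - 1) * Real.exp (-(m ^ 2 * t)) * (Real.Gamma s)⁻¹) s (Real.Gamma s)⁻¹ := by
  have hG : 0 < Real.Gamma s := Real.Gamma_pos_of_pos hs
  have hpos : ∀ ξ : EuclideanSpace ℝ (Fin n), 0 < massiveSymbol n s m ξ := fun ξ => by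
    unfold massiveSymbol; positivity
  have heq : ∀ ξ : EuclideanSpace ℝ (Fin n), ∫ t in Set.Ioi (0 : ℝ),
      t ^ (s - 1) * Real.exp (-(m ^ 2 * t)) * (Real.Gamma s)⁻¹ *
        Real.exp (-(t * (2 * Real.pi * ‖ξ‖) ^ 2)) = massiveSymbol n s m ξ := by
    intro ξ
    have hL : 0 < (2 * Real.pi * ‖ξ‖) ^ 2 + m ^ 2 := by positivity
    have h := Real.integral_rpow_mul_exp_neg_mul_Ioi hs hL
    have hcongr : ∀ t : ℝ, t ^ (s - 1) * Real.exp (-(m ^ 2 * t)) * (Real.Gamma s)⁻¹ *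
        Real.exp (-(t * (2 * Real.pi * ‖ξ‖) ^ 2)) =
        t ^ (s - 1) * Real.exp (-(((2 * Real.pi * ‖ξ‖) ^ 2 + m ^ 2) * t)) * (Real.Gamma s)⁻¹ := by
      intro t
      rw [show -(((2 * Real.pi * ‖ξ‖) ^ 2 + m ^ 2) * t) =
        -(m ^ 2 * t) + -(t * (2 * Real.pi * ‖ξ‖) ^ 2) by ring, Real.exp_add]
      ring
    simp_rw [hcongr]
    rw [integral_mul_const, h, mul_assoc, mul_inv_cancel₀ hG.ne', mul_one, massiveSymbol,
      one_div, Real.inv_rpow hL.le, Real.rpow_neg hL.le]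
  refine ⟨?_, ⟨(m ^ 2) ^ (-s), fun ξ => ?_⟩, ?_, fun t ht => ?_, fun t ht => ?_, ?_, ?_⟩
  · unfold massiveSymbol; fun_prop
  · rw [abs_of_pos (hpos ξ)]
    refine Real.rpow_le_rpow_of_nonpos (by positivity) ?_ (by linarith)
    exact le_add_of_nonneg_left (by positivity)
  · fun_prop
  · positivity
  · rw [mul_comm]
    gcongr
    refine mul_le_of_le_one_right (by positivity) (Real.exp_le_one_iff.2 ?_)
    exact neg_nonpos.2 (by positivity)
  · refine Filter.Eventually.of_forall fun ξ => ?_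
    -- A non-integrable function has Bochner integral 0, so the nonzero value already computed
    -- forces integrability.
    refine Integrable.of_integral_ne_zero ?_
    rw [heq ξ]
    exact (hpos ξ).ne'
  · exact Filter.Eventually.of_forall heq

/-- The weight whose Laplace transform at `l²` is `(l + 1)⁻¹`. -/
noncomputable def masslessWeight (t : ℝ) : ℝ :=
  2 / Real.pi * ∫ b in Set.Ioi (0 : ℝ), b ^ 2 / (b ^ 2 + 1) * Real.exp (-t * b ^ 2)

theorem measurable_masslessWeight : Measurable masslessWeight := by
  have h : StronglyMeasurable fun z : ℝ × ℝ =>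
      z.2 ^ 2 / (z.2 ^ 2 + 1) * Real.exp (-z.1 * z.2 ^ 2) :=
    Measurable.stronglyMeasurable (by fun_prop)
  exact h.integral_prod_right'.measurable.const_mul _

theorem masslessWeight_nonneg (t : ℝ) : 0 ≤ masslessWeight t :=
  mul_nonneg (by positivity) (integral_nonneg fun b => by positivity)

theorem sq_div_sq_add_one_le_one (b : ℝ) : b ^ 2 / (b ^ 2 + 1) ≤ 1 := by
  rw [div_le_one (by positivity)]; linarith

/-- Dropping `b²/(b²+1) ≤ 1` leaves half a Gaussian integral, hence the bound `(πt)^(-1/2)`: the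
same constant `1/Γ(1/2)` as in the massive case. -/
theorem masslessWeight_le {t : ℝ} (ht : 0 < t) :
    masslessWeight t ≤ (Real.Gamma (1 / 2))⁻¹ * t ^ ((1 / 2 : ℝ) - 1) := by
  have hle : ∫ b in Set.Ioi (0 : ℝ), b ^ 2 / (b ^ 2 + 1) * Real.exp (-t * b ^ 2) ≤
      √(Real.pi / t) / 2 := by
    rw [← integral_gaussian_Ioi t]
    refine integral_mono_of_nonneg (Filter.Eventually.of_forall fun b => by positivity)
      (integrable_exp_neg_mul_sq ht).integrableOn (Filter.Eventually.of_forall fun b => ?_)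
    exact mul_le_of_le_one_left (Real.exp_pos _).le (sq_div_sq_add_one_le_one b)
  refine (mul_le_mul_of_nonneg_left hle (by positivity)).trans (le_of_eq ?_)
  rw [Real.Gamma_one_half_eq, show (1 / 2 : ℝ) - 1 = -(1 / 2) by norm_num,
    Real.rpow_neg ht.le, ← Real.sqrt_eq_rpow, Real.sqrt_div Real.pi_pos.le]
  have h1 : 0 < √Real.pi := Real.sqrt_pos.2 Real.pi_pos
  have h2 : 0 < √t := Real.sqrt_pos.2 ht
  have h3 : √Real.pi * √Real.pi = Real.pi := Real.mul_self_sqrt Real.pi_pos.le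
  field_simp
  nlinarith

theorem integrableOn_inv_sq_add_sq {l : ℝ} (hl : 0 < l) :
    IntegrableOn (fun b : ℝ => (b ^ 2 + l ^ 2)⁻¹) (Set.Ioi 0) ∧
      ∫ b in Set.Ioi (0 : ℝ), (b ^ 2 + l ^ 2)⁻¹ = Real.pi / (2 * l) := by
  have hfun : (fun b : ℝ => (b ^ 2 + l ^ 2)⁻¹) =
      fun b => (l ^ 2)⁻¹ * (1 + (l⁻¹ * b) ^ 2)⁻¹ := by
    ext b
    rw [← mul_inv]
    congr 1
    field_simp
    ring
  rw [hfun]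
  refine ⟨?_, ?_⟩
  · exact ((integrable_inv_one_add_sq.comp_mul_left' (inv_ne_zero hl.ne')).const_mul _).integrableOn
  · rw [integral_const_mul, integral_comp_mul_left_Ioi (fun b => (1 + b ^ 2)⁻¹) 0 (inv_pos.2 hl),
      mul_zero, integral_Ioi_inv_one_add_sq]
    simp
    field_simp

/-- Partial fractions in `b²` reduce this to two arctangent integrals; the denominator `l² - 1` is
why `l = 1` is left out. -/
theorem integral_sq_div_mul_inv {l : ℝ} (hl : 0 < l) (hl1 : l ≠ 1) :
    IntegrableOn (fun b : ℝ => b ^ 2 / (b ^ 2 + 1) * (b ^ 2 + l ^ 2)⁻¹) (Set.Ioi 0) ∧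
      ∫ b in Set.Ioi (0 : ℝ), b ^ 2 / (b ^ 2 + 1) * (b ^ 2 + l ^ 2)⁻¹ =
        Real.pi / 2 * (l + 1)⁻¹ := by
  have hne : l ^ 2 - 1 ≠ 0 := by
    have : l - 1 ≠ 0 := sub_ne_zero.2 hl1
    have : l + 1 ≠ 0 := by positivity
    rw [show l ^ 2 - 1 = (l - 1) * (l + 1) by ring]
    positivity
  have hfun : (fun b : ℝ => b ^ 2 / (b ^ 2 + 1) * (b ^ 2 + l ^ 2)⁻¹) = fun b =>
      l ^ 2 / (l ^ 2 - 1) * (b ^ 2 + l ^ 2)⁻¹ - 1 / (l ^ 2 - 1) * (b ^ 2 + 1 ^ 2)⁻¹ := by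
    ext b
    have h1 : b ^ 2 + 1 ≠ 0 := by positivity
    have h2 : b ^ 2 + l ^ 2 ≠ 0 := by positivity
    rw [one_pow]
    field_simp
    ring
  obtain ⟨i1, e1⟩ := integrableOn_inv_sq_add_sq hl
  obtain ⟨i2, e2⟩ := integrableOn_inv_sq_add_sq one_pos
  rw [hfun]
  refine ⟨(i1.const_mul _).sub (i2.const_mul _), ?_⟩
  rw [integral_sub (i1.const_mul _) (i2.const_mul _), integral_const_mul, integral_const_mul,
    e1, e2]
  have : l + 1 ≠ 0 := by positivity
  field_simp
  ring

/-- Exchanging the integrals and doing the `t` integral first turns the exponential into `(b² +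
l²)⁻¹`. -/
theorem integral_masslessWeight_mul_exp {l : ℝ} (hl : 0 < l) (hl1 : l ≠ 1) :
    ∫ t in Set.Ioi (0 : ℝ), masslessWeight t * Real.exp (-(t * l ^ 2)) = (l + 1)⁻¹ := by
  set g : ℝ → ℝ → ℝ := fun b t =>
    b ^ 2 / (b ^ 2 + 1) * Real.exp (-(b ^ 2 + l ^ 2) * t) with hg
  obtain ⟨hi, he⟩ := integral_sq_div_mul_inv hl hl1
  have hneg : ∀ b : ℝ, -(b ^ 2 + l ^ 2) < 0 := fun b => by
    rw [neg_lt_zero]; positivity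
  have ht : ∀ b : ℝ, ∫ t in Set.Ioi (0 : ℝ), g b t =
      b ^ 2 / (b ^ 2 + 1) * (b ^ 2 + l ^ 2)⁻¹ := fun b => by
    rw [integral_const_mul, integral_exp_mul_Ioi (hneg b), mul_zero, Real.exp_zero, neg_div_neg_eq,
      one_div]
  have hmeas : AEStronglyMeasurable (Function.uncurry g)
      ((volume.restrict (Set.Ioi (0 : ℝ))).prod (volume.restrict (Set.Ioi (0 : ℝ)))) := by
    refine Measurable.aestronglyMeasurable ?_
    simp only [hg, Function.uncurry_def]
    fun_prop
  have hint : Integrable (Function.uncurry g)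
      ((volume.restrict (Set.Ioi (0 : ℝ))).prod (volume.restrict (Set.Ioi (0 : ℝ)))) := by
    rw [integrable_prod_iff hmeas]
    refine ⟨Filter.Eventually.of_forall fun b =>
      (integrableOn_exp_mul_Ioi (hneg b) 0).const_mul (b ^ 2 / (b ^ 2 + 1)), ?_⟩
    refine Integrable.congr hi (Filter.Eventually.of_forall fun b => ?_)
    simp only [Function.uncurry_apply_pair]
    rw [← ht b]
    refine integral_congr_ae (Filter.Eventually.of_forall fun t => ?_)
    simp only [hg]
    rw [Real.norm_of_nonneg (by positivity)]
  have hswap := integral_integral_swap hint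
  simp_rw [ht] at hswap
  rw [he] at hswap
  have hw : ∀ t : ℝ, masslessWeight t * Real.exp (-(t * l ^ 2)) =
      2 / Real.pi * ∫ b in Set.Ioi (0 : ℝ), g b t := by
    intro t
    rw [masslessWeight, mul_assoc, ← integral_mul_const]
    congr 1
    refine integral_congr_ae (Filter.Eventually.of_forall fun b => ?_)
    simp only [hg]
    rw [mul_assoc, ← Real.exp_add]
    ring_nf
  simp_rw [hw]
  rw [integral_const_mul, ← hswap]
  have := Real.pi_ne_zero
  field_simp

theorem isSubordinated_masslessSymbol {n : ℕ} (hn : 1 ≤ n) :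
    IsSubordinated (masslessSymbol n) masslessWeight (1 / 2) (Real.Gamma (1 / 2))⁻¹ := by
  have : Nonempty (Fin n) := ⟨⟨0, hn⟩⟩
  -- The excluded values `l = 0` and `l = 1` of `l = 2π‖ξ‖` correspond to the origin and one sphere,
  -- both null since `n ≥ 1`.
  have hsphere : ∀ a : ℝ, ∀ᵐ ξ : EuclideanSpace ℝ (Fin n), ‖ξ‖ ≠ a := by
    intro a
    rw [ae_iff]
    have h := Measure.addHaar_sphere (volume : Measure (EuclideanSpace ℝ (Fin n))) 0 a
    convert h using 2
    ext ξ
    simp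
  have heq : ∀ᵐ ξ : EuclideanSpace ℝ (Fin n), ∫ t in Set.Ioi (0 : ℝ),
      masslessWeight t * Real.exp (-(t * (2 * Real.pi * ‖ξ‖) ^ 2)) = masslessSymbol n ξ := by
    filter_upwards [hsphere 0, hsphere (2 * Real.pi)⁻¹] with ξ h0 h1
    have hξ : 0 < ‖ξ‖ := lt_of_le_of_ne (norm_nonneg ξ) h0.symm
    refine integral_masslessWeight_mul_exp (by positivity) fun h => h1 ?_
    rw [eq_inv_of_mul_eq_one_right h]
  have hpos : ∀ ξ : EuclideanSpace ℝ (Fin n), 0 < masslessSymbol n ξ := fun ξ => by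
    unfold masslessSymbol; positivity
  refine ⟨?_, ⟨1, fun ξ => ?_⟩, measurable_masslessWeight, fun t _ => masslessWeight_nonneg t,
    fun t ht => masslessWeight_le ht, ?_, heq⟩
  · unfold masslessSymbol; fun_prop
  · rw [abs_of_pos (hpos ξ)]
    refine inv_le_one_of_one_le₀ ?_
    have : 0 ≤ 2 * Real.pi * ‖ξ‖ := by positivity
    linarith
  · filter_upwards [heq] with ξ hξ
    refine Integrable.of_integral_ne_zero ?_
    rw [hξ]
    exact (hpos ξ).ne'

end Symbols

theorem mainTheorem3 (n : ℕ) (hn : 1 ≤ n) (s : ℝ) (hs0 : 0 < s) (hs1 : s < 1)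
    (r : ℝ≥0∞) (hr1 : 1 ≤ r) (hr : r ≠ ⊤) :
    ∃ c : ℝ, 0 < c ∧
      ∀ (β : Fin n → ℕ), 2 ≤ ∑ i, β i →
      ∀ (p q q' : ℝ≥0∞) [Fact (1 ≤ p)] [Fact (1 ≤ q')], p ≠ ⊤ → 1 < q → q ≠ ⊤ →
        p⁻¹ + q⁻¹ + r⁻¹ = 2 → q⁻¹ + q'⁻¹ = 1 →
      ∀ (Φ χ : EuclideanSpace ℝ (Fin n) → ℂ),
        ContDiff ℝ ∞ Φ → MemLp Φ ∞ volume → ContDiff ℝ ∞ χ → MemLp χ ∞ volume →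
      ∀ d : ℝ, 0 < d → (∀ x ∈ tsupport χ, ∀ y ∈ tsupport Φ, d ≤ dist x y) →
        (∀ m : ℝ, 0 < m →
          ∃ T : Lp ℂ p (volume : Measure (EuclideanSpace ℝ (Fin n))) →L[ℂ]
              Lp ℂ q' (volume : Measure (EuclideanSpace ℝ (Fin n))),
            IsLocalizedOperator (massiveSymbol n s m) β Φ χ T ∧
            ‖T‖ ≤ smoothingBound c s r β d Φ χ) ∧
        (s = 1 / 2 →
          ∃ T : Lp ℂ p (volume : Measure (EuclideanSpace ℝ (Fin n))) →L[ℂ]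
              Lp ℂ q' (volume : Measure (EuclideanSpace ℝ (Fin n))),
            IsLocalizedOperator (masslessSymbol n) β Φ χ T ∧
            ‖T‖ ≤ smoothingBound c (1 / 2) r β d Φ χ) := by
  have hC : 0 < (Real.Gamma s)⁻¹ := inv_pos.2 (Real.Gamma_pos_of_pos hs0)
  -- At `s = 1/2` both weights obey the bound with constant `1/Γ(1/2)`, so one `c` serves both
  -- operators.
  refine ⟨tailConst n s (Real.Gamma s)⁻¹ r, tailConst_pos hC hs0 hs1 r, ?_⟩
  intro β hβ p q q' _ _ hp hq1 hq hpqr hqq Φ χ hΦ hΦb _ hχb d hd hdist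
  refine ⟨fun m hm => ?_, fun hs => ?_⟩
  · exact (isSubordinated_massiveSymbol n hs0 hm).exists_localizedOperator hn hs0 hs1 hC hβ hr1 hr
      hp hq1 hq hpqr hqq hΦ hΦb hχb hd hdist
  · subst hs
    exact (isSubordinated_masslessSymbol hn).exists_localizedOperator hn hs0 hs1 hC hβ hr1 hr
      hp hq1 hq hpqr hqq hΦ hΦb hχb hd hdist
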